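/- Let $G$ be a finite simple planar graph, let $I_s, I_t$ be independent sets of $G$, each of size $k$, and put $X := I_s\cup I_t$. For $Y\subseteq X$ let $\mathcal C_Y:=\{v\in V(G)\setminus X : N(v)\cap X=Y\}$; if $|Y|=2$, then $\mathcal C_Y$ is called a *2-class* and the two elements of $Y$ are its *key vertices*. Let $\mathcal C_2$ denote the union of all 2-classes. Let $J\in\{I_s,I_t\}$ and let $I\subseteq \mathcal C_2$ be an independent set. - $I$ is *$J$-greedy* if there are an ordering $i_1,\dots,i_k$ of $J$ and distinct vertices $j_1,\dots,j_k\in I$ such that $\{j_1,\dots,j_t,i_{t+1},\dots,i_k\}$ is independent for every $0\le t\le k$. - $I$ is *weakly $J$-greedy* with $I$-activation pair $\{j_1,j_2\}$ if $k\ge 2$ and there are an ordering $i_1,\dots,i_k$ of $J$ and distinct vertices $j_1,\dots,j_k\in I$ such that $\{j_1,\dots,j_t,i_{t+1},\dots,i_k\}$ is independent for every $2\le t\le k$. - $I$ is *3-clean for $J$* if, for some 2-class $C$, we have $|C\cap I|\ge 3$ and $I$ is weakly $J$-greedy with an $I$-activation pair contained in $C$. - $I$ is *$(2,2)$-clean for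 $J$* if there are two distinct 2-classes $C,C'$ with a common key vertex such that $|C\cap I|=2$, $|C'\cap I|\ge 2$, and $I$ is weakly $J$-greedy with $I$-activation pair $C\cap I$. - $I$ is *clean for $J$* if it is $J$-greedy, 3-clean for $J$, or $(2,2)$-clean for $J$. If $|\mathcal C_2|\ge 21k$, then there exists an independent set $I\subseteq\mathcal C_2$ with $|I|\le 2k$ that is clean for $I_s$ and clean for $I_t$. -/

import Mathlib

open scoped Finset

namespace TokenJumping

/-- A graph is planar if it can be drawn in the Euclidean plane: vertices are distinct points, each
edge is a simple arc joining its two ends (the two orientations `d`, `d.symm` of an edge trace the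
same arc), an arc passes through no vertex other than its ends, and the arcs of two distinct edges
meet only at vertices. -/
def IsPlanar {V : Type*} (G : SimpleGraph V) : Prop :=
  ∃ (p : V → EuclideanSpace ℝ (Fin 2)) (γ : ∀ d : G.Dart, Path (p d.fst) (p d.snd)),
    Function.Injective p ∧
    (∀ d, Function.Injective (γ d)) ∧
    (∀ d, Set.range (γ d.symm) = Set.range (γ d)) ∧
    (∀ d v, p v ∈ Set.range (γ d) → v = d.fst ∨ v = d.snd) ∧
    (∀ d d' : G.Dart, d.edge ≠ d'.edge →
      Set.range (γ d) ∩ Set.range (γ d') ⊆ Set.range p)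

section Classes

variable {V : Type*} [Fintype V] [DecidableEq V] (G : SimpleGraph V) [DecidableRel G.Adj]

/-- The `X`-projection class of `Y`: the vertices outside `X` whose neighbours in `X` are exactly
the vertices of `Y`. -/
def projClass (X Y : Finset V) : Finset V :=
  {v | v ∉ X ∧ {x ∈ X | G.Adj v x} = Y}

/-- The union of all 2-classes, that is, of the classes of the 2-element subsets of `X`. -/
def twoClassVertices (X : Finset V) : Finset V :=
  (X.powersetCard 2).biUnion (projClass G X)

end Classes

section Greedy

variable {V : Type*} [DecidableEq V] (G : SimpleGraph V)

/-- `{j₁, …, jₜ, iₜ₊₁, …, iₖ}` (the entries are indexed from `0` in the code). -/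
def hybrid {k : ℕ} (i j : Fin k → V) (t : ℕ) : Set V :=
  {v | (∃ a : Fin k, (a : ℕ) < t ∧ v = j a) ∨ (∃ a : Fin k, t ≤ (a : ℕ) ∧ v = i a)}

/-- `i` is an ordering `i₁, …, iₖ` of all of `J` (where `k = |J|`), `j` is a sequence `j₁, …, jₖ` of
distinct vertices of `I`, and `{j₁, …, jₜ, iₜ₊₁, …, iₖ}` is independent for all `r ≤ t ≤ k`. -/
def IsGreedyOrder (r : ℕ) (J I : Finset V) (i j : Fin #J → V) : Prop :=
  Function.Injective i ∧ (∀ a, i a ∈ J) ∧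
  Function.Injective j ∧ (∀ a, j a ∈ I) ∧
  ∀ t : ℕ, r ≤ t → t ≤ #J → G.IsIndepSet (hybrid i j t)

/-- `I` is `J`-greedy: the tokens on `J` can be moved one by one onto vertices of `I`. -/
def IsGreedy (J I : Finset V) : Prop :=
  ∃ i j : Fin #J → V, IsGreedyOrder G 0 J I i j

/-- `I` is weakly `J`-greedy with `I`-activation pair `{a, b}`: the first two moves, from the
`J`-activation pair `{i₁, i₂}` to `{j₁, j₂} = {a, b}`, are made together. -/
def IsWeaklyGreedyWith (J I : Finset V) (a b : V) : Prop :=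
  ∃ h : 2 ≤ #J, ∃ i j : Fin #J → V, IsGreedyOrder G 2 J I i j ∧
    j ⟨0, by omega⟩ = a ∧ j ⟨1, by omega⟩ = b

end Greedy

section Clean

variable {V : Type*} [Fintype V] [DecidableEq V] (G : SimpleGraph V) [DecidableRel G.Adj]

/-- `I` is 3-clean for `J`, with set of key vertices `X`. -/
def IsThreeClean (X J I : Finset V) : Prop :=
  ∃ Y ⊆ X, #Y = 2 ∧ 3 ≤ #(projClass G X Y ∩ I) ∧
    ∃ a ∈ projClass G X Y, ∃ b ∈ projClass G X Y, IsWeaklyGreedyWith G J I a b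

/-- `I` is (2,2)-clean for `J`, with set of key vertices `X`: two distinct 2-classes `C`, `C'` with a
common key vertex `x` each contain two vertices of `I`, and the `I`-activation pair is `C ∩ I`. -/
def IsTwoTwoClean (X J I : Finset V) : Prop :=
  ∃ Y ⊆ X, ∃ Y' ⊆ X, #Y = 2 ∧ #Y' = 2 ∧ Y ≠ Y' ∧ (∃ x, x ∈ Y ∧ x ∈ Y') ∧
    2 ≤ #(projClass G X Y' ∩ I) ∧
    ∃ a b, projClass G X Y ∩ I = {a, b} ∧ IsWeaklyGreedyWith G J I a b

/-- `I` is clean for `J`, with set of key vertices `X`. -/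
def IsClean (X J I : Finset V) : Prop :=
  IsGreedy G J I ∨ IsThreeClean G X J I ∨ IsTwoTwoClean G X J I

end Clean

end TokenJumping

/-! Call `I` rich if it has three vertices in one 2-class, or two in each of two 2-classes sharing a
key vertex. Richness refers only to `X`, so one set can serve both `I_s` and `I_t`: by
`IsRich.isClean`, for |J| ≥ 2 a rich independent subset of the 2-classes with at least |J| vertices
is clean for J.

For S ⊆ J let f(S) be the number of vertices of `I` whose J-neighbours all lie in S. An ordering of
J works if its first t elements have f ≥ t for every t ≥ 2, since distinct targets can then be
picked greedily. Richness yields a set S₀ of at most three key vertices with f(S₀) > |S₀|. Vertices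
of `I` have at most two neighbours in J, so double counting allows J to be peeled down to S₀ while
keeping f(S) ≥ |S| (`exists_erase_settled`).

Planarity supplies a large rich set. There are at most 3|X| - 5 nonempty classes, six vertices of
one class contain an independent triple, and two classes of at least four vertices sharing a key
vertex contain the two required pairs. Hence more than 10|X| - 15 vertices contain a rich
independent set Q of at most four (`IsPlanar.exists_rich`). Among 21k vertices, Q can be chosen with
low degrees, leaving at least 6k - 5 vertices not adjacent to it, a sixth of which are independent
(`IsPlanar.exists_large_rich`).

Planarity is used only through the absence of K₅ and K₃,₃ minors, obtained from the drawing by a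
parity argument with winding numbers. The bound of 3n - 5 edges then follows by contracting edges
until a K₅ appears. -/

namespace TokenJumping

/-! ### Winding numbers and the non-planarity of K₅ and K₃,₃ -/

section ContinuousLog

open Complex

/-- Every nowhere vanishing continuous function on a simply connected, locally path-connected space
has a continuous logarithm. -/
theorem exists_continuous_log {A : Type*} [TopologicalSpace A] [SimplyConnectedSpace A]
    [LocallyPathConnectedSpace A] {f : A → ℂ} (hf : Continuous f) (h0 : ∀ a, f a ≠ 0) :
    ∃ L : A → ℂ, Continuous L ∧ ∀ a, exp (L a) = f a := by
  obtain ⟨a₀⟩ : Nonempty A := inferInstance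
  obtain ⟨F, ⟨-, hF⟩, -⟩ := isCoveringMapOn_exp.existsUnique_continuousMap_lifts
    (⟨f, hf⟩ : C(A, ℂ)) (exp_log (h0 a₀)) (fun a => h0 a)
  exact ⟨F, F.continuous, fun a => congrFun hF a⟩

/-- Two continuous logarithms of the same function have the same increments. -/
theorem continuous_log_sub_eq {L L' : ℝ → ℂ} (hL : Continuous L) (hL' : Continuous L')
    (h : ∀ s, exp (L s) = exp (L' s)) (s t : ℝ) : L s - L t = L' s - L' t := by
  have hu := isCoveringMapOn_exp.existsUnique_continuousMap_lifts
    (⟨fun s => exp (L s), by fun_prop⟩ : C(ℝ, ℂ)) (a₀ := t) (e₀ := L t) rfl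
    (fun a => exp_ne_zero _)
  have key := hu.unique (y₁ := ⟨L, hL⟩) (y₂ := ⟨fun s => L' s + (L t - L' t), by fun_prop⟩)
    ⟨rfl, rfl⟩ ⟨by simp, by
      ext s
      simp only [Function.comp_apply, ContinuousMap.coe_mk]
      rw [exp_add, exp_sub, ← h s, ← h t, div_self (exp_ne_zero _), mul_one]⟩
  have := DFunLike.congr_fun key s
  simp only [ContinuousMap.coe_mk] at this
  rw [this]; ring

open Classical in
/-- The increment over `[0, 1]` of a continuous logarithm of `g`. -/
noncomputable def logChange (g : ℝ → ℂ) : ℂ :=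
  if h : ∃ L : ℝ → ℂ, Continuous L ∧ ∀ s, exp (L s) = g s then h.choose 1 - h.choose 0 else 0

theorem logChange_eq {g L : ℝ → ℂ} (hL : Continuous L) (h : ∀ s, exp (L s) = g s) :
    logChange g = L 1 - L 0 := by
  have hex : ∃ L : ℝ → ℂ, Continuous L ∧ ∀ s, exp (L s) = g s := ⟨L, hL, h⟩
  rw [logChange, dif_pos hex]
  exact continuous_log_sub_eq hex.choose_spec.1 hL
    (fun s => (hex.choose_spec.2 s).trans (h s).symm) 1 0

/-- For two disjoint curves, moving first one and then the other endpoint of the connecting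
vector, in either order, changes its logarithm by the same amount. -/
theorem logChange_square {γ δ : ℝ → ℂ} (hγ : Continuous γ) (hδ : Continuous δ)
    (hd : ∀ s t, γ s ≠ δ t) :
    logChange (fun s => γ s - δ 0) + logChange (fun t => δ t - γ 1) =
      logChange (fun s => γ s - δ 1) + logChange (fun t => δ t - γ 0) ∧
    exp (logChange (fun s => γ s - δ 0)) = (γ 1 - δ 0) / (γ 0 - δ 0) ∧
    exp (logChange (fun t => δ t - γ 1)) = (δ 1 - γ 1) / (δ 0 - γ 1) ∧
    exp (logChange (fun s => γ s - δ 1)) = (γ 1 - δ 1) / (γ 0 - δ 1) ∧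
    exp (logChange (fun t => δ t - γ 0)) = (δ 1 - γ 0) / (δ 0 - γ 0) := by
  obtain ⟨L, hL, h⟩ := exists_continuous_log (A := ℝ × ℝ) (f := fun x => γ x.1 - δ x.2)
    (by fun_prop) (fun x => sub_ne_zero.2 (hd _ _))
  have h' : ∀ s t, exp (L (s, t)) = γ s - δ t := fun s t => h (s, t)
  have h'' : ∀ s t, exp (L (s, t) + Real.pi * I) = δ t - γ s := fun s t => by
    rw [exp_add, h', exp_pi_mul_I]; ring
  have e1 : ∀ t, logChange (fun s => γ s - δ t) = L (1, t) - L (0, t) := fun t =>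
    logChange_eq (L := fun s => L (s, t)) (by fun_prop) (fun s => h' s t)
  have e2 : ∀ s, logChange (fun t => δ t - γ s) = L (s, 1) - L (s, 0) := fun s => by
    rw [logChange_eq (L := fun t => L (s, t) + Real.pi * I) (by fun_prop) (fun t => h'' s t)]
    ring
  refine ⟨by rw [e1, e1, e2, e2]; ring, ?_, ?_, ?_, ?_⟩
  · rw [e1, exp_sub, h', h']
  · rw [e2, ← add_sub_add_right_eq_sub _ _ (Real.pi * I : ℂ), exp_sub, h'', h'']
  · rw [e1, exp_sub, h', h']
  · rw [e2, ← add_sub_add_right_eq_sub _ _ (Real.pi * I : ℂ), exp_sub, h'', h'']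

/-- The indicator of `w < v`. -/
def ltIndicator (m : ℕ) (v w : Fin m) : ℤ := if w < v then 1 else 0

/-- A fixed choice of logarithms of the vectors `p w - p v`. -/
noncomputable def dirLog {m : ℕ} (p : Fin m → ℂ) (v w : Fin m) : ℂ :=
  log (p (max v w) - p (min v w)) + ltIndicator m v w * (Real.pi * I)

theorem exp_dirLog {m : ℕ} {p : Fin m → ℂ} {v w : Fin m} (h : p v ≠ p w) :
    exp (dirLog p v w) = p w - p v := by
  unfold dirLog ltIndicator
  rcases lt_or_ge w v with hvw | hvw
  · rw [max_eq_left hvw.le, min_eq_right hvw.le, exp_add, exp_log (sub_ne_zero.2 h), if_pos hvw]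
    push_cast
    rw [one_mul, exp_pi_mul_I]; ring
  · rw [max_eq_right hvw, min_eq_left hvw, exp_add, exp_log (sub_ne_zero.2 h.symm),
      if_neg (not_lt.2 hvw)]
    simp

/-- The van Kampen relations: curves drawn for the edges of a graph such that disjoint edges
receive disjoint curves have integer winding numbers around the vertices obeying a linear system. -/
theorem exists_winding_relation {m : ℕ} (p : Fin m → ℂ) (γ : Fin m → Fin m → ℝ → ℂ)
    (E : Fin m → Fin m → Prop) (hc : ∀ i j, E i j → Continuous (γ i j))
    (h0 : ∀ i j, E i j → γ i j 0 = p i) (h1 : ∀ i j, E i j → γ i j 1 = p j)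
    (hd : ∀ i j k l, E i j → E k l → i ≠ k → i ≠ l → j ≠ k → j ≠ l →
      ∀ s t, γ i j s ≠ γ k l t) :
    ∃ n : Fin m → Fin m → Fin m → ℤ, ∀ i j k l, E i j → E k l →
      i ≠ k → i ≠ l → j ≠ k → j ≠ l →
      2 * (n k i j + n j k l - n l i j - n i k l) =
        ltIndicator m k i - ltIndicator m k j + ltIndicator m j k - ltIndicator m j l
          + ltIndicator m l j - ltIndicator m l i
          + ltIndicator m i l - ltIndicator m i k := by
  -- `n v i j` counts the turns of the curve of `ij` around `v` relative to `dirLog`. The premises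
  -- sit inside the existential so that one total function can be chosen.
  have key : ∀ v i j : Fin m, ∃ n : ℤ, p v ≠ p i → p v ≠ p j →
      exp (logChange (fun s => γ i j s - p v)) = (p j - p v) / (p i - p v) →
      logChange (fun s => γ i j s - p v) =
        dirLog p v j - dirLog p v i + n * (2 * Real.pi * I) := by
    intro v i j
    by_cases h : p v ≠ p i ∧ p v ≠ p j ∧
      exp (logChange (fun s => γ i j s - p v)) = (p j - p v) / (p i - p v)
    · obtain ⟨n, hn⟩ := exp_eq_exp_iff_exists_int.1 (show
        exp (logChange (fun s => γ i j s - p v)) = exp (dirLog p v j - dirLog p v i) by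
          rw [h.2.2, exp_sub, exp_dirLog h.1, exp_dirLog h.2.1])
      exact ⟨n, fun _ _ _ => hn⟩
    · exact ⟨0, fun a b c => absurd ⟨a, b, c⟩ h⟩
  choose n hn using key
  refine ⟨n, fun i j k l hij hkl hik hil hjk hjl => ?_⟩
  have hd' := hd i j k l hij hkl hik hil hjk hjl
  obtain ⟨hs, s1, s2, s3, s4⟩ := logChange_square (hc i j hij) (hc k l hkl) hd'
  have nik : p i ≠ p k := by simpa only [h0 i j hij, h0 k l hkl] using hd' 0 0
  have nil : p i ≠ p l := by simpa only [h0 i j hij, h1 k l hkl] using hd' 0 1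
  have njk : p j ≠ p k := by simpa only [h1 i j hij, h0 k l hkl] using hd' 1 0
  have njl : p j ≠ p l := by simpa only [h1 i j hij, h1 k l hkl] using hd' 1 1
  simp only [h0 i j hij, h1 i j hij, h0 k l hkl, h1 k l hkl] at hs s1 s2 s3 s4
  rw [hn k i j nik.symm njk.symm s1, hn j k l njk njl s2, hn l i j nil.symm njl.symm s3,
    hn i k l nik nil s4] at hs
  -- `dirLog p v w` and `dirLog p w v` share the same principal logarithm and differ only in the
  -- indicator. All logarithms therefore cancel, leaving integer multiples of πi.
  simp only [dirLog, max_comm k j, min_comm k j, max_comm k i, min_comm k i, max_comm l j,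
    min_comm l j, max_comm l i, min_comm l i] at hs
  have hpi : (Real.pi * I : ℂ) ≠ 0 := by simp [Real.pi_ne_zero]
  have := mul_right_cancel₀ (b := (Real.pi * I : ℂ))
    (a := ((2 * (n k i j + n j k l - n l i j - n i k l) : ℤ) : ℂ))
    (c := ((ltIndicator m k i - ltIndicator m k j + ltIndicator m j k - ltIndicator m j l
          + ltIndicator m l j - ltIndicator m l i
          + ltIndicator m i l - ltIndicator m i k : ℤ) : ℂ)) hpi (by push_cast; linear_combination hs)
  exact_mod_cast this

/-- Halve the relations and add them modulo 2. Each `n v i j` occurs in exactly two of them, so the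
left side is even. The right side is odd exactly for pairs of edges whose ends interleave, the
crossings of a convex drawing, and K₅ has five of these. -/
theorem no_completeGraph_five_drawing (p : Fin 5 → ℂ) (γ : Fin 5 → Fin 5 → ℝ → ℂ)
    (hc : ∀ i j, i < j → Continuous (γ i j))
    (h0 : ∀ i j, i < j → γ i j 0 = p i) (h1 : ∀ i j, i < j → γ i j 1 = p j)
    (hd : ∀ i j k l, i < j → k < l → i ≠ k → i ≠ l → j ≠ k → j ≠ l →
      ∀ s t, γ i j s ≠ γ k l t) : False := by
  obtain ⟨n, hn⟩ := exists_winding_relation p γ (· < ·) hc h0 h1 hd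
  have r : ∀ i j k l : Fin 5, i < j → k < l → i ≠ k → i ≠ l → j ≠ k → j ≠ l → _ := hn
  have a1 := r 0 1 2 3 (by decide) (by decide) (by decide) (by decide) (by decide) (by decide)
  have a2 := r 0 1 2 4 (by decide) (by decide) (by decide) (by decide) (by decide) (by decide)
  have a3 := r 0 1 3 4 (by decide) (by decide) (by decide) (by decide) (by decide) (by decide)
  have a4 := r 0 2 1 3 (by decide) (by decide) (by decide) (by decide) (by decide) (by decide)
  have a5 := r 0 2 1 4 (by decide) (by decide) (by decide) (by decide) (by decide) (by decide)
  have a6 := r 0 2 3 4 (by decide) (by decide) (by decide) (by decide) (by decide) (by decide)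
  have a7 := r 0 3 1 2 (by decide) (by decide) (by decide) (by decide) (by decide) (by decide)
  have a8 := r 0 3 1 4 (by decide) (by decide) (by decide) (by decide) (by decide) (by decide)
  have a9 := r 0 3 2 4 (by decide) (by decide) (by decide) (by decide) (by decide) (by decide)
  have b1 := r 0 4 1 2 (by decide) (by decide) (by decide) (by decide) (by decide) (by decide)
  have b2 := r 0 4 1 3 (by decide) (by decide) (by decide) (by decide) (by decide) (by decide)
  have b3 := r 0 4 2 3 (by decide) (by decide) (by decide) (by decide) (by decide) (by decide)
  have b4 := r 1 2 3 4 (by decide) (by decide) (by decide) (by decide) (by decide) (by decide)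
  have b5 := r 1 3 2 4 (by decide) (by decide) (by decide) (by decide) (by decide) (by decide)
  have b6 := r 1 4 2 3 (by decide) (by decide) (by decide) (by decide) (by decide) (by decide)
  simp only [ltIndicator, Fin.isValue, Fin.reduceLT, if_true, if_false] at *
  omega

/-- The same parity count: every winding number again occurs twice, and nine pairs of edges
interleave. -/
theorem no_completeBipartite_three_drawing (p : Fin 6 → ℂ) (γ : Fin 6 → Fin 6 → ℝ → ℂ)
    (hc : ∀ i j, i < 3 → 3 ≤ j → Continuous (γ i j))
    (h0 : ∀ i j, i < 3 → 3 ≤ j → γ i j 0 = p i)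
    (h1 : ∀ i j, i < 3 → 3 ≤ j → γ i j 1 = p j)
    (hd : ∀ i j k l, i < 3 → 3 ≤ j → k < 3 → 3 ≤ l → i ≠ k → j ≠ l →
      ∀ s t, γ i j s ≠ γ k l t) : False := by
  obtain ⟨n, hn⟩ := exists_winding_relation p γ (fun i j => i < 3 ∧ 3 ≤ j)
    (fun i j h => hc i j h.1 h.2) (fun i j h => h0 i j h.1 h.2) (fun i j h => h1 i j h.1 h.2)
    (fun i j k l h h' hik _ _ hjl => hd i j k l h.1 h.2 h'.1 h'.2 hik hjl)
  have r : ∀ i j k l : Fin 6, i < k → k < 3 → 3 ≤ j → 3 ≤ l → j ≠ l → _ :=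
    fun i j k l hik hk hj hl hjl => hn i j k l ⟨hik.trans hk, hj⟩ ⟨hk, hl⟩ hik.ne
      ((hik.trans hk).trans_le hl).ne (hk.trans_le hj).ne' hjl
  have a1 := r 0 3 1 4 (by decide) (by decide) (by decide) (by decide) (by decide)
  have a2 := r 0 3 1 5 (by decide) (by decide) (by decide) (by decide) (by decide)
  have a3 := r 0 4 1 3 (by decide) (by decide) (by decide) (by decide) (by decide)
  have a4 := r 0 4 1 5 (by decide) (by decide) (by decide) (by decide) (by decide)
  have a5 := r 0 5 1 3 (by decide) (by decide) (by decide) (by decide) (by decide)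
  have a6 := r 0 5 1 4 (by decide) (by decide) (by decide) (by decide) (by decide)
  have b1 := r 0 3 2 4 (by decide) (by decide) (by decide) (by decide) (by decide)
  have b2 := r 0 3 2 5 (by decide) (by decide) (by decide) (by decide) (by decide)
  have b3 := r 0 4 2 3 (by decide) (by decide) (by decide) (by decide) (by decide)
  have b4 := r 0 4 2 5 (by decide) (by decide) (by decide) (by decide) (by decide)
  have b5 := r 0 5 2 3 (by decide) (by decide) (by decide) (by decide) (by decide)
  have b6 := r 0 5 2 4 (by decide) (by decide) (by decide) (by decide) (by decide)
  have c1 := r 1 3 2 4 (by decide) (by decide) (by decide) (by decide) (by decide)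
  have c2 := r 1 3 2 5 (by decide) (by decide) (by decide) (by decide) (by decide)
  have c3 := r 1 4 2 3 (by decide) (by decide) (by decide) (by decide) (by decide)
  have c4 := r 1 4 2 5 (by decide) (by decide) (by decide) (by decide) (by decide)
  have c5 := r 1 5 2 3 (by decide) (by decide) (by decide) (by decide) (by decide)
  have c6 := r 1 5 2 4 (by decide) (by decide) (by decide) (by decide) (by decide)
  simp only [ltIndicator, Fin.isValue, Fin.reduceLT, if_true, if_false] at *
  omega

end ContinuousLog

/-! ### Excluded minors of planar graphs -/

section Minors

variable {V W : Type*} {G : SimpleGraph V}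

/-- Any two vertices of `S` are joined by a walk of `G` inside `S`. -/
def Linked (G : SimpleGraph V) (S : Set V) : Prop :=
  ∀ x ∈ S, ∀ y ∈ S, ∃ w : G.Walk x y, ∀ z ∈ w.support, z ∈ S

theorem Linked.empty : Linked G ∅ := fun _ h => h.elim

theorem Linked.singleton (x : V) : Linked G {x} := by
  rintro _ rfl _ rfl
  exact ⟨.nil, by simp⟩

theorem Linked.union {S T : Set V} (hS : Linked G S) (hT : Linked G T) {a b : V} (ha : a ∈ S)
    (hb : b ∈ T) (hab : G.Adj a b) : Linked G (S ∪ T) := by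
  have key : ∀ x ∈ S, ∀ y ∈ T, ∃ w : G.Walk x y, ∀ z ∈ w.support, z ∈ S ∪ T := by
    intro x hx y hy
    obtain ⟨w, hw⟩ := hS x hx a ha
    obtain ⟨w', hw'⟩ := hT b hb y hy
    refine ⟨w.append (.cons hab w'), fun z hz => ?_⟩
    rw [SimpleGraph.Walk.mem_support_append_iff, SimpleGraph.Walk.support_cons,
      List.mem_cons] at hz
    rcases hz with h | rfl | h
    exacts [.inl (hw _ h), .inl ha, .inr (hw' _ h)]
  rintro x (hx | hx) y (hy | hy)
  · obtain ⟨w, hw⟩ := hS x hx y hy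
    exact ⟨w, fun z hz => .inl (hw z hz)⟩
  · exact key x hx y hy
  · obtain ⟨w, hw⟩ := key y hy x hx
    exact ⟨w.reverse, fun z hz => hw z (by simpa using hz)⟩
  · obtain ⟨w, hw⟩ := hT x hx y hy
    exact ⟨w, fun z hz => .inr (hw z hz)⟩

theorem Linked.of_center {S : Set V} {c : V} (hc : c ∈ S) (h : ∀ x ∈ S, x = c ∨ G.Adj c x) :
    Linked G S := by
  have key : ∀ x ∈ S, ∃ w : G.Walk c x, ∀ z ∈ w.support, z ∈ S := by
    intro x hx
    rcases h x hx with rfl | h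
    · exact ⟨.nil, by simpa using hx⟩
    · exact ⟨.cons h .nil, by simp [hc, hx]⟩
  intro x hx y hy
  obtain ⟨w, hw⟩ := key x hx
  obtain ⟨w', hw'⟩ := key y hy
  refine ⟨w.reverse.append w', fun z hz => ?_⟩
  rw [SimpleGraph.Walk.mem_support_append_iff] at hz
  rcases hz with h | h
  · exact hw z (by simpa using h)
  · exact hw' z h

/-- `H` is a minor of `G`. Branch sets may be empty, which allows `H` to have additional isolated
vertices. -/
def IsMinor (H : SimpleGraph W) (G : SimpleGraph V) : Prop :=
  ∃ B : W → Set V, (∀ a, Linked G (B a)) ∧ (∀ a b, a ≠ b → Disjoint (B a) (B b)) ∧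
    ∀ a b, H.Adj a b → ∃ x ∈ B a, ∃ y ∈ B b, G.Adj x y

theorem IsMinor.mono {H H' : SimpleGraph W} (h : IsMinor H G) (hle : H' ≤ H) : IsMinor H' G := by
  obtain ⟨B, h1, h2, h3⟩ := h
  exact ⟨B, h1, h2, fun a b hab => h3 a b (hle hab)⟩

theorem isMinor_of_le {H : SimpleGraph V} (hle : H ≤ G) : IsMinor H G :=
  ⟨fun v => {v}, fun v => .singleton v, fun a b hab => by simpa using hab,
    fun a b hab => ⟨a, rfl, b, rfl, hle hab⟩⟩

theorem IsMinor.comap {W' : Type*} {H : SimpleGraph W} (h : IsMinor H G) (f : W' → W)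
    (hf : Function.Injective f) : IsMinor (H.comap f) G := by
  obtain ⟨B, h1, h2, h3⟩ := h
  exact ⟨B ∘ f, fun a => h1 _, fun a b hab => h2 _ _ (hf.ne hab), fun a b hab => h3 _ _ hab⟩

/-- A drawing of `G` as in `IsPlanar`, with values in the complex plane, gives disjoint
path-connected sets for disjoint linked sets of vertices. -/
theorem IsPlanar.exists_regions (hG : IsPlanar G) :
    ∃ (p : V → ℂ) (D : Set V → Set ℂ), (∀ S T, Disjoint S T → Disjoint (D S) (D T)) ∧
      ∀ S, Linked G S → ∀ x ∈ S, ∀ y ∈ S, JoinedIn (D S) (p x) (p y) := by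
  obtain ⟨p, γ, hp, -, -, hv, hdis⟩ := hG
  let φ : EuclideanSpace ℝ (Fin 2) → ℂ := fun x => ⟨x 0, x 1⟩
  have hφ : Continuous φ := by
    have : φ = fun x => (x 0 : ℂ) + (x 1 : ℂ) * Complex.I := by
      ext x; apply Complex.ext <;> simp [φ]
    rw [this]; fun_prop
  have hφi : Function.Injective φ := by
    intro x y h
    have h0 := congrArg Complex.re h
    have h1 := congrArg Complex.im h
    ext i
    fin_cases i
    exacts [h0, h1]
  -- The part of the plane covered by the drawing of the subgraph induced on `S`.
  let D : Set V → Set (EuclideanSpace ℝ (Fin 2)) := fun S =>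
    {x | (∃ v ∈ S, x = p v) ∨ ∃ d : G.Dart, d.fst ∈ S ∧ d.snd ∈ S ∧ x ∈ Set.range (γ d)}
  have hvd : ∀ S T : Set V, Disjoint S T → ∀ v ∈ S, ∀ d : G.Dart, d.fst ∈ T → d.snd ∈ T →
      p v ∉ Set.range (γ d) := by
    intro S T hST v hvS d h1 h2 hx
    rcases hv d v hx with rfl | rfl
    exacts [Set.disjoint_left.1 hST hvS h1, Set.disjoint_left.1 hST hvS h2]
  refine ⟨φ ∘ p, fun S => φ '' D S, fun S T hST => ?_, fun S hS x hx y hy => ?_⟩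
  · rw [Set.disjoint_image_iff hφi, Set.disjoint_left]
    rintro z (⟨v, hvS, rfl⟩ | ⟨d, h1, h2, hz⟩) (⟨w, hwT, h⟩ | ⟨d', h1', h2', hz'⟩)
    · exact Set.disjoint_left.1 hST hvS (hp h ▸ hwT)
    · exact hvd S T hST v hvS d' h1' h2' hz'
    · subst h
      exact hvd T S hST.symm w hwT d h1 h2 hz
    · have hne : d.edge ≠ d'.edge := by
        intro h
        rcases SimpleGraph.dart_edge_eq_iff d d' |>.1 h with rfl | rfl
        · exact Set.disjoint_left.1 hST h1 h1'
        · exact Set.disjoint_left.1 hST h1 h2'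
      obtain ⟨v, rfl⟩ := hdis d d' hne ⟨hz, hz'⟩
      rcases hv d v hz with rfl | rfl
      · exact hvd S T hST _ h1 d' h1' h2' hz'
      · exact hvd S T hST _ h2 d' h1' h2' hz'
  · obtain ⟨w, hw⟩ := hS x hx y hy
    have key : ∀ {x y : V} (w : G.Walk x y), (∀ z ∈ w.support, z ∈ S) →
        JoinedIn (D S) (p x) (p y) := by
      intro x y w
      induction w with
      | nil => exact fun h => JoinedIn.refl (.inl ⟨_, h _ (by simp), rfl⟩)
      | @cons u v w hadj q ih =>
        intro h
        refine JoinedIn.trans ⟨γ ⟨(u, v), hadj⟩, fun t => .inr ⟨⟨(u, v), hadj⟩, ?_, ?_, t, rfl⟩⟩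
          (ih fun z hz => h z (by simp [hz]))
        · exact h u (by simp)
        · exact h v (by simp)
    exact ((key w hw).map_continuousOn hφ.continuousOn)

/-- An edge between two branch sets becomes a curve between chosen representatives. For disjoint
edges of the minor these curves stay in disjoint regions, as the drawing obstructions require. -/
theorem IsPlanar.exists_curve (hG : IsPlanar G) :
    ∃ (p : V → ℂ) (D : Set V → Set ℂ), (∀ S T, Disjoint S T → Disjoint (D S) (D T)) ∧
      ∀ S T, Linked G S → Linked G T → (∃ x ∈ S, ∃ y ∈ T, G.Adj x y) → ∀ x ∈ S, ∀ y ∈ T,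
        ∃ c : ℝ → ℂ, Continuous c ∧ c 0 = p x ∧ c 1 = p y ∧ ∀ s, c s ∈ D (S ∪ T) := by
  obtain ⟨p, D, h1, h2⟩ := hG.exists_regions
  refine ⟨p, D, h1, fun S T hS hT ⟨a, ha, b, hb, hab⟩ x hx y hy => ?_⟩
  obtain ⟨c, hc⟩ := h2 _ (hS.union hT ha hb hab) x (.inl hx) y (.inr hy)
  exact ⟨c.extend, c.continuous_extend, c.extend_zero, c.extend_one, fun s => hc _⟩

theorem disjoint_union_union {B : W → Set V} (hB : ∀ a b, a ≠ b → Disjoint (B a) (B b))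
    {i j k l : W} (hik : i ≠ k) (hil : i ≠ l) (hjk : j ≠ k) (hjl : j ≠ l) :
    Disjoint (B i ∪ B j) (B k ∪ B l) := by
  rw [Set.disjoint_union_left, Set.disjoint_union_right, Set.disjoint_union_right]
  exact ⟨⟨hB _ _ hik, hB _ _ hil⟩, hB _ _ hjk, hB _ _ hjl⟩

theorem IsPlanar.not_isMinor_completeGraph_five (hG : IsPlanar G) :
    ¬ IsMinor (⊤ : SimpleGraph (Fin 5)) G := by
  rintro ⟨B, hl, hB, ha⟩
  obtain ⟨p, D, hD, hc⟩ := hG.exists_curve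
  have hne : ∀ i, ∃ x, x ∈ B i := by
    intro i
    obtain ⟨x, hx, -⟩ := ha i (i + 1) (by fin_cases i <;> decide)
    exact ⟨x, hx⟩
  choose r hr using hne
  have hcur : ∀ i j : Fin 5, ∃ c : ℝ → ℂ, i < j → Continuous c ∧ c 0 = p (r i) ∧ c 1 = p (r j) ∧
      ∀ s, c s ∈ D (B i ∪ B j) := by
    intro i j
    by_cases h : i < j
    · obtain ⟨c, hc⟩ := hc _ _ (hl i) (hl j) (ha i j h.ne) _ (hr i) _ (hr j)
      exact ⟨c, fun _ => hc⟩
    · exact ⟨0, fun h' => absurd h' h⟩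
  choose γ hγ using hcur
  refine no_completeGraph_five_drawing (p ∘ r) γ (fun i j h => (hγ i j h).1)
    (fun i j h => (hγ i j h).2.1) (fun i j h => (hγ i j h).2.2.1) ?_
  intro i j k l hij hkl h1 h2 h3 h4 s t hst
  exact Set.disjoint_left.1 (hD _ _ (disjoint_union_union hB h1 h2 h3 h4))
    ((hγ i j hij).2.2.2 s) (hst ▸ (hγ k l hkl).2.2.2 t)

theorem IsPlanar.not_bipartite_model (hG : IsPlanar G) (B : Fin 6 → Set V)
    (hl : ∀ i, Linked G (B i)) (hB : ∀ i j, i ≠ j → Disjoint (B i) (B j))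
    (ha : ∀ i j : Fin 6, i < 3 → 3 ≤ j → ∃ x ∈ B i, ∃ y ∈ B j, G.Adj x y) : False := by
  obtain ⟨p, D, hD, hc⟩ := hG.exists_curve
  have hne : ∀ i, ∃ x, x ∈ B i := by
    intro i
    rcases lt_or_ge i 3 with h | h
    · obtain ⟨x, hx, -⟩ := ha i 3 h le_rfl
      exact ⟨x, hx⟩
    · obtain ⟨-, -, x, hx, -⟩ := ha 0 i (by decide) h
      exact ⟨x, hx⟩
  choose r hr using hne
  have hcur : ∀ i j : Fin 6, ∃ c : ℝ → ℂ, i < 3 → 3 ≤ j → Continuous c ∧ c 0 = p (r i) ∧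
      c 1 = p (r j) ∧ ∀ s, c s ∈ D (B i ∪ B j) := by
    intro i j
    by_cases h : i < 3 ∧ 3 ≤ j
    · obtain ⟨c, hc⟩ := hc _ _ (hl i) (hl j) (ha i j h.1 h.2) _ (hr i) _ (hr j)
      exact ⟨c, fun _ _ => hc⟩
    · exact ⟨0, fun h' h'' => absurd ⟨h', h''⟩ h⟩
  choose γ hγ using hcur
  refine no_completeBipartite_three_drawing (p ∘ r) γ (fun i j h h' => (hγ i j h h').1)
    (fun i j h h' => (hγ i j h h').2.1) (fun i j h h' => (hγ i j h h').2.2.1) ?_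
  intro i j k l hi hj hk hl' h1 h2 s t hst
  exact Set.disjoint_left.1 (hD _ _ (disjoint_union_union hB h1 (hi.trans_le hl').ne
    (hk.trans_le hj).ne' h2)) ((hγ i j hi hj).2.2.2 s) (hst ▸ (hγ k l hk hl').2.2.2 t)

/-- A planar graph has no `K₃,₃` minor; the case where only one branch set is not a singleton. -/
theorem IsPlanar.no_bipartite_star (hG : IsPlanar G) {u v : V} {S : Set V} (hS : Linked G S)
    {a b c : V} (huv : u ≠ v) (hab : a ≠ b) (hac : a ≠ c) (hbc : b ≠ c)
    (huS : u ∉ S) (hvS : v ∉ S) (haS : a ∉ S) (hbS : b ∉ S) (hcS : c ∉ S)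
    (hua : G.Adj u a) (hub : G.Adj u b) (huc : G.Adj u c)
    (hva : G.Adj v a) (hvb : G.Adj v b) (hvc : G.Adj v c)
    (hSa : ∃ x ∈ S, G.Adj x a) (hSb : ∃ x ∈ S, G.Adj x b) (hSc : ∃ x ∈ S, G.Adj x c) :
    False := by
  have n1 := hua.ne
  have n2 := hub.ne
  have n3 := huc.ne
  have n4 := hva.ne
  have n5 := hvb.ne
  have n6 := hvc.ne
  refine hG.not_bipartite_model ![{u}, {v}, S, {a}, {b}, {c}] ?_ ?_ ?_
  · intro i
    fin_cases i
    exacts [.singleton u, .singleton v, hS, .singleton a, .singleton b, .singleton c]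
  · have key : ∀ i j : Fin 6, i < j → Disjoint
        ((![{u}, {v}, S, {a}, {b}, {c}] : Fin 6 → Set V) i)
        ((![{u}, {v}, S, {a}, {b}, {c}] : Fin 6 → Set V) j) := by
      intro i j hij
      fin_cases i <;> fin_cases j <;> first
        | exact absurd hij (by decide)
        | simp [*, Ne.symm]
    intro i j hij
    rcases lt_or_gt_of_ne hij with h | h
    exacts [key i j h, (key j i h).symm]
  · intro i j hi hj
    fin_cases i <;> fin_cases j <;> first
      | exact absurd hi (by decide)
      | exact absurd hj (by decide)
      | simpa using ‹_›

theorem IsPlanar.not_clique_five (hG : IsPlanar G) {H : SimpleGraph W} (hH : IsMinor H G)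
    {s : Finset W} (hs : H.IsNClique 5 s) : False := by
  refine hG.not_isMinor_completeGraph_five ?_
  let e : Fin 5 ≃ s := (Fintype.equivFinOfCardEq (by simp [hs.card_eq])).symm
  have hf : Function.Injective (fun i => (e i : W)) := Subtype.val_injective.comp e.injective
  refine (hH.comap _ hf).mono fun i j hij => ?_
  exact hs.isClique (e i).2 (e j).2 (hf.ne hij)

end Minors

/-! ### Edge contraction and the bound of 3n - 5 edges -/

section EdgeBound

variable {V W : Type*} {G : SimpleGraph V}

/-- The graph obtained from `H` by contracting `v` into `u`; the vertex `v` becomes isolated. -/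
def contract (H : SimpleGraph W) (u v : W) : SimpleGraph W where
  Adj a b := a ≠ b ∧ a ≠ v ∧ b ≠ v ∧ (H.Adj a b ∨ (a = u ∧ H.Adj v b) ∨ (b = u ∧ H.Adj a v))
  symm := ⟨by
    rintro a b ⟨h, ha, hb, h1 | ⟨h1, h2⟩ | ⟨h1, h2⟩⟩
    exacts [⟨h.symm, hb, ha, .inl h1.symm⟩, ⟨h.symm, hb, ha, .inr (.inr ⟨h1, h2.symm⟩)⟩,
      ⟨h.symm, hb, ha, .inr (.inl ⟨h1, h2.symm⟩)⟩]⟩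
  loopless := ⟨fun a h => h.1 rfl⟩

/-- The branch set of `v` is merged into that of `u` and replaced by the empty set, so the vertex
type stays the same. -/
theorem IsMinor.contract {H : SimpleGraph W} (hH : IsMinor H G) {u v : W} (huv : H.Adj u v) :
    IsMinor (contract H u v) G := by
  classical
  obtain ⟨B, hl, hB, ha⟩ := hH
  have hBu : ∀ w, w ≠ u → w ≠ v → Disjoint (B u ∪ B v) (B w) := fun w h h' =>
    Set.disjoint_union_left.2 ⟨hB _ _ h.symm, hB _ _ h'.symm⟩
  refine ⟨fun w => if w = u then B u ∪ B v else if w = v then ∅ else B w, fun w => ?_,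
    fun a b hab => ?_, fun a b hab => ?_⟩
  · dsimp only
    split_ifs
    · obtain ⟨x, hx, y, hy, hxy⟩ := ha u v huv
      exact (hl u).union (hl v) hx hy hxy
    · exact .empty
    · exact hl w
  · dsimp only
    split_ifs with h1 h2 h3 h4 h5 h6 h7
    · exact absurd (h1.trans h2.symm) hab
    · simp
    · exact hBu b h2 h3
    · simp
    · simp
    · simp
    · exact (hBu a h1 h4).symm
    · simp
    · exact hB a b hab
  · have hsub : ∀ w, w ≠ v → B w ⊆ if w = u then B u ∪ B v else if w = v then ∅ else B w := by
      intro w hw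
      split_ifs with h
      · subst h; exact Set.subset_union_left
      · exact subset_rfl
    obtain ⟨-, hav, hbv, h | ⟨rfl, h⟩ | ⟨rfl, h⟩⟩ := hab
    · obtain ⟨x, hx, y, hy, hxy⟩ := ha a b h
      exact ⟨x, hsub a hav hx, y, hsub b hbv hy, hxy⟩
    · obtain ⟨x, hx, y, hy, hxy⟩ := ha v b h
      exact ⟨x, by simp [hx], y, hsub b hbv hy, hxy⟩
    · obtain ⟨x, hx, y, hy, hxy⟩ := ha a v h
      exact ⟨x, hsub a hav hx, y, by simp [hy], hxy⟩

open Classical in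
/-- Contracting an edge destroys that edge and one edge for each triangle containing it. -/
theorem card_edgeFinset_le_contract [Fintype W] (H : SimpleGraph W) {u v : W} (huv : H.Adj u v) :
    #H.edgeFinset ≤ #(contract H u v).edgeFinset + 1 + #{w | H.Adj u w ∧ H.Adj v w} := by
  -- Edges away from `v` survive, and each vertex of `N` becomes a new neighbour of `u`. What is
  -- lost is `uv` and one edge per common neighbour.
  set A : Finset (Sym2 W) := H.edgeFinset \ H.incidenceFinset v with hA
  set N : Finset W := {w | H.Adj v w ∧ ¬ H.Adj u w ∧ w ≠ u} with hN
  have h1 : #H.edgeFinset = #A + H.degree v := by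
    rw [hA, Finset.card_sdiff_of_subset (H.incidenceFinset_subset v),
      H.card_incidenceFinset_eq_degree]
    have := Finset.card_le_card (H.incidenceFinset_subset v)
    rw [H.card_incidenceFinset_eq_degree] at this
    omega
  have h2 : H.degree v ≤ #N + 1 + #{w | H.Adj u w ∧ H.Adj v w} := by
    have : H.neighborFinset v ⊆
        (N ∪ {u}) ∪ Finset.univ.filter (fun w => H.Adj u w ∧ H.Adj v w) := by
      intro w hw
      simp only [SimpleGraph.mem_neighborFinset] at hw
      simp only [hN, Finset.mem_union, Finset.mem_filter, Finset.mem_univ, true_and,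
        Finset.mem_singleton]
      tauto
    calc H.degree v = #(H.neighborFinset v) := (H.card_neighborFinset_eq_degree v).symm
      _ ≤ _ := Finset.card_le_card this
      _ ≤ _ := Finset.card_union_le _ _
      _ ≤ _ := by
        gcongr
        exact Finset.card_union_le _ _
  have h3 : A ∪ N.image (fun w => s(u, w)) ⊆ (contract H u v).edgeFinset := by
    intro e
    induction e with | _ a b =>
    simp only [hA, hN, Finset.mem_union, Finset.mem_sdiff, SimpleGraph.mem_edgeFinset,
      SimpleGraph.mem_edgeSet, SimpleGraph.mem_incidenceFinset, SimpleGraph.mk'_mem_incidenceSet_iff,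
      Finset.mem_image, Finset.mem_filter, Finset.mem_univ, true_and]
    rintro (⟨h, h'⟩ | ⟨w, ⟨hw1, hw2, hw3⟩, hw⟩)
    · refine ⟨h.ne, ?_, ?_, .inl h⟩
      · rintro rfl; exact h' ⟨h, .inl rfl⟩
      · rintro rfl; exact h' ⟨h, .inr rfl⟩
    · rcases Sym2.eq_iff.1 hw with ⟨rfl, rfl⟩ | ⟨rfl, rfl⟩
      · exact ⟨hw3.symm, huv.ne, hw1.ne', .inr (.inl ⟨rfl, hw1⟩)⟩
      · exact ⟨hw3, hw1.ne', huv.ne, .inr (.inr ⟨rfl, hw1.symm⟩)⟩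
  have h4 : Disjoint A (N.image (fun w => s(u, w))) := by
    rw [Finset.disjoint_right]
    intro e he hA'
    obtain ⟨w, hw, rfl⟩ := Finset.mem_image.1 he
    rw [hN, Finset.mem_filter] at hw
    rw [hA, Finset.mem_sdiff, SimpleGraph.mem_edgeFinset, SimpleGraph.mem_edgeSet] at hA'
    exact hw.2.2.1 hA'.1
  have h5 := Finset.card_le_card h3
  rw [Finset.card_union_of_disjoint h4, Finset.card_image_of_injective _
    (fun x y h => Sym2.congr_right.1 h)] at h5
  omega

open Classical in
/-- If the neighbourhood of a vertex `v` of degree at most `5` induces a nonempty graph of minimum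
degree at least `3`, then contracting at most one edge produces a clique on five vertices. -/
theorem exists_clique_five_of_degree_le [Fintype W] {H : SimpleGraph W} {v : W}
    (h5 : H.degree v ≤ 5) (h0 : H.degree v ≠ 0)
    (h3 : ∀ u, H.Adj v u → 3 ≤ #{w | H.Adj u w ∧ H.Adj v w}) :
    (∃ s, H.IsNClique 5 s) ∨ ∃ a c, H.Adj a c ∧ ∃ s, (contract H a c).IsNClique 5 s := by
  set N := H.neighborFinset v with hN
  have hNc : #N = H.degree v := H.card_neighborFinset_eq_degree v
  have hmem : ∀ w, w ∈ N ↔ H.Adj v w := fun w => by simp [hN]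
  -- As `#N ≤ 5`, every vertex of `N` misses at most one other, so the non-edges inside `N` form a
  -- matching.
  have hnon : ∀ u ∈ N, #{w ∈ N | w ≠ u ∧ ¬ H.Adj u w} + 4 ≤ #N := by
    intro u hu
    have hsub : ({w | H.Adj u w ∧ H.Adj v w} : Finset W) ∪ {u} ⊆
        N \ {w ∈ N | w ≠ u ∧ ¬ H.Adj u w} := by
      intro w
      simp only [Finset.mem_union, Finset.mem_filter, Finset.mem_univ, true_and,
        Finset.mem_singleton, Finset.mem_sdiff, hmem]
      rintro (⟨h, h'⟩ | rfl)
      · exact ⟨h', fun hh => hh.2.2 h⟩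
      · exact ⟨(hmem _).1 hu, fun hh => hh.2.1 rfl⟩
    have hc := Finset.card_le_card hsub
    rw [Finset.card_union_of_disjoint (by simp), Finset.card_singleton,
      Finset.card_sdiff_of_subset (Finset.filter_subset _ _)] at hc
    have := h3 u ((hmem u).1 hu)
    omega
  have hne : N.Nonempty := by rw [← Finset.card_pos]; omega
  have hN4 : 4 ≤ #N := by
    obtain ⟨u, hu⟩ := hne
    have := hnon u hu
    omega
  have huniq : ∀ u ∈ N, ∀ x ∈ N, ∀ y ∈ N, x ≠ u → y ≠ u → ¬ H.Adj u x → ¬ H.Adj u y → x = y := by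
    intro u hu x hx y hy hxu hyu hux huy
    have := hnon u hu
    refine Finset.card_le_one.1 (show #{w ∈ N | w ≠ u ∧ ¬ H.Adj u w} ≤ 1 by omega) x ?_ y ?_
    · simp [hx, hxu, hux]
    · simp [hy, hyu, huy]
  by_cases hcl : H.IsClique (N : Set W)
  · left
    obtain ⟨s, hs, hs4⟩ := Finset.exists_subset_card_eq hN4
    refine ⟨insert v s, SimpleGraph.IsNClique.insert ⟨hcl.subset (by exact_mod_cast hs), hs4⟩
      fun b hb => (hmem b).1 (hs hb)⟩
  · right
    have hN5 : #N = 5 := by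
      by_contra hN5
      refine hcl fun x hx y hy hxy => ?_
      by_contra hadj
      have := hnon x hx
      have h0 : #{w ∈ N | w ≠ x ∧ ¬ H.Adj x w} = 0 := by omega
      rw [Finset.card_eq_zero, Finset.filter_eq_empty_iff] at h0
      exact h0 hy ⟨hxy.symm, hadj⟩
    simp only [SimpleGraph.IsClique, Set.Pairwise, not_forall] at hcl
    obtain ⟨a, ha, b, hb, hab, hnab⟩ := hcl
    have ha' : a ∈ N := ha
    have hb' : b ∈ N := hb
    have hcard : #((N.erase a).erase b) = 3 := by
      rw [Finset.card_erase_of_mem (by simp [hab.symm, hb']), Finset.card_erase_of_mem ha', hN5]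
    -- The three vertices other than `a` and `b` span at most one non-edge, so they can be labelled
    -- with `d`, `e` adjacent. Contracting `c` into `a` then supplies the missing adjacency of `a`
    -- and `b`.
    have hpick : ∃ c d e, c ∈ N ∧ d ∈ N ∧ e ∈ N ∧ c ≠ a ∧ c ≠ b ∧ d ≠ a ∧ d ≠ b ∧ e ≠ a ∧ e ≠ b ∧
        c ≠ d ∧ c ≠ e ∧ d ≠ e ∧ H.Adj d e := by
      obtain ⟨c, d, e, hcd, hce, hde, hs⟩ := Finset.card_eq_three.1 hcard
      have hm : ∀ w, w ∈ (N.erase a).erase b ↔ w = c ∨ w = d ∨ w = e := fun w => by simp [hs]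
      have hc := (hm c).2 (by simp)
      have hd := (hm d).2 (by simp)
      have he := (hm e).2 (by simp)
      simp only [Finset.mem_erase] at hc hd he
      by_cases h : H.Adj d e
      · exact ⟨c, d, e, hc.2.2, hd.2.2, he.2.2, hc.2.1, hc.1, hd.2.1, hd.1, he.2.1, he.1,
          hcd, hce, hde, h⟩
      · refine ⟨d, e, c, hd.2.2, he.2.2, hc.2.2, hd.2.1, hd.1, he.2.1, he.1, hc.2.1, hc.1,
          hde, hcd.symm, hce.symm, ?_⟩
        by_contra h'
        exact hcd (huniq e he.2.2 c hc.2.2 d hd.2.2 hce hde h' (fun h'' => h h''.symm))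
    obtain ⟨c, d, e, hc, hd, he, hca, hcb, hda, hdb, hea, heb, hcd, hce, hde, hade⟩ := hpick
    have adja : ∀ w ∈ N, w ≠ a → w ≠ b → H.Adj a w := by
      intro w hw hwa hwb
      by_contra h
      exact hwb (huniq a ha' w hw b hb' hwa hab.symm h hnab)
    have adjb : ∀ w ∈ N, w ≠ a → w ≠ b → H.Adj b w := by
      intro w hw hwa hwb
      by_contra h
      exact hwa (huniq b hb' w hw a ha' hwb hab h (fun h => hnab h.symm))
    refine ⟨a, c, adja c hc hca hcb, {v, a, b, d, e}, ?_⟩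
    have hva := ((hmem a).1 ha')
    have hvb := ((hmem b).1 hb')
    have hvc := ((hmem c).1 hc)
    have hvd := ((hmem d).1 hd)
    have hve := ((hmem e).1 he)
    have lift : ∀ x y, H.Adj x y → x ≠ c → y ≠ c → (contract H a c).Adj x y :=
      fun x y h hx hy => ⟨h.ne, hx, hy, .inl h⟩
    have hde' : (contract H a c).IsNClique 3 {b, d, e} := by
      rw [SimpleGraph.is3Clique_triple_iff]
      exact ⟨lift _ _ (adjb d hd hda hdb) hcb.symm hcd.symm,
        lift _ _ (adjb e he hea heb) hcb.symm hce.symm, lift _ _ hade hcd.symm hce.symm⟩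
    refine (hde'.insert (a := a) ?_).insert (a := v) ?_
    · intro x hx
      simp only [Finset.mem_insert, Finset.mem_singleton] at hx
      rcases hx with rfl | rfl | rfl
      · exact ⟨hab, hca.symm, hcb.symm, .inr (.inl ⟨rfl, (adjb c hc hca hcb).symm⟩)⟩
      · exact lift _ _ (adja _ hd hda hdb) hca.symm hcd.symm
      · exact lift _ _ (adja _ he hea heb) hca.symm hce.symm
    · intro x hx
      simp only [Finset.mem_insert, Finset.mem_singleton] at hx
      rcases hx with rfl | rfl | rfl | rfl
      · exact lift _ _ hva hvc.ne hca.symm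
      · exact lift _ _ hvb hvc.ne hcb.symm
      · exact lift _ _ hvd hvc.ne hcd.symm
      · exact lift _ _ hve hvc.ne hce.symm

open Classical in
/-- A minor of a planar graph with `n ≥ 2` vertices has at most `3n - 5` edges. -/
theorem IsPlanar.card_edgeFinset_minor_le [Fintype W] (hG : IsPlanar G) (n : ℕ) (hn : 2 ≤ n) :
    ∀ (S : Finset W) (H : SimpleGraph W), #S = n → IsMinor H G → (∀ a b, H.Adj a b → a ∈ S) →
      #H.edgeFinset + 5 ≤ 3 * n := by
  induction n, hn using Nat.le_induction with
  | base =>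
    intro S H hS _ hHS
    obtain ⟨x, y, hxy, rfl⟩ := Finset.card_eq_two.1 hS
    have : H.edgeFinset ⊆ {s(x, y)} := by
      intro e
      induction e with | _ a b =>
      rw [SimpleGraph.mem_edgeFinset, SimpleGraph.mem_edgeSet, Finset.mem_singleton]
      intro h
      have ha := hHS a b h
      have hb := hHS b a h.symm
      have := h.ne
      simp only [Finset.mem_insert, Finset.mem_singleton] at ha hb
      rcases ha with rfl | rfl <;> rcases hb with rfl | rfl
      exacts [absurd rfl this, rfl, Sym2.eq_swap, absurd rfl this]
    have := Finset.card_le_card this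
    simp only [Finset.card_singleton] at this
    omega
  | succ n hn ih =>
    intro S H₀ hS hH₀ hHS₀
    by_contra hlt
    -- Keep exactly 3n - 1 edges, one more than allowed on n + 1 vertices. The degree sum 6n - 2 is
    -- then below 6(n + 1), which forces a vertex of degree at most five.
    obtain ⟨F, hF, hFc⟩ := Finset.exists_subset_card_eq
      (show 3 * n - 1 ≤ #H₀.edgeFinset by omega)
    obtain ⟨H, hHdef⟩ : ∃ H : SimpleGraph W, H = .fromEdgeSet (F : Set (Sym2 W)) := ⟨_, rfl⟩
    have hle : H ≤ H₀ := by
      intro a b h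
      rw [hHdef, SimpleGraph.fromEdgeSet_adj] at h
      have := hF (Finset.mem_coe.1 h.1)
      rwa [SimpleGraph.mem_edgeFinset] at this
    have hE : #H.edgeFinset = 3 * n - 1 := by
      rw [← hFc]
      congr 1
      ext e
      simp only [SimpleGraph.mem_edgeFinset, hHdef, SimpleGraph.edgeSet_fromEdgeSet]
      refine ⟨fun h => h.1, fun h => ⟨h, fun hd => ?_⟩⟩
      have := hF h
      rw [SimpleGraph.mem_edgeFinset] at this
      exact H₀.not_isDiag_of_mem_edgeSet this hd
    have hH := hH₀.mono hle
    have hHS : ∀ a b, H.Adj a b → a ∈ S := fun a b h => hHS₀ a b (hle h)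
    -- Contraction leaves at most 3n - 5 edges by induction. At least four are thus lost, and all
    -- but one of the losses come from triangles on `uv`.
    have hcontract : ∀ u v, H.Adj u v → 3 ≤ #{w | H.Adj v w ∧ H.Adj u w} := by
      intro u v huv
      have h1 := card_edgeFinset_le_contract H huv.symm
      have h2 := ih (S.erase u) (contract H v u)
        (by rw [Finset.card_erase_of_mem (hHS u v huv), hS]; rfl) (hH.contract huv.symm) (by
          rintro a b ⟨-, hav, -, h | ⟨rfl, h⟩ | ⟨rfl, h⟩⟩
          · exact Finset.mem_erase.2 ⟨hav, hHS _ _ h⟩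
          · exact Finset.mem_erase.2 ⟨hav, hHS _ _ huv.symm⟩
          · exact Finset.mem_erase.2 ⟨hav, hHS _ _ h⟩)
      omega
    have hsum : ∑ v ∈ S, H.degree v = 2 * (3 * n - 1) := by
      rw [← hE, ← H.sum_degrees_eq_twice_card_edges]
      refine Finset.sum_subset (Finset.subset_univ S) fun v _ hv => ?_
      rw [← H.card_neighborFinset_eq_degree, Finset.card_eq_zero, Finset.eq_empty_iff_forall_notMem]
      intro w hw
      exact hv (hHS v w (by simpa using hw))
    obtain ⟨v, hvS, hv5⟩ : ∃ v ∈ S, H.degree v ≤ 5 := by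
      by_contra! h
      have := Finset.card_nsmul_le_sum S _ 6 (fun v hv => h v hv)
      rw [hsum, hS, smul_eq_mul] at this
      omega
    by_cases hv0 : H.degree v = 0
    · have h2 := ih (S.erase v) H (by rw [Finset.card_erase_of_mem hvS, hS]; rfl) hH (by
        intro a b h
        refine Finset.mem_erase.2 ⟨?_, hHS _ _ h⟩
        rintro rfl
        exact hv0.not_gt ((H.degree_pos_iff_exists_adj _).2 ⟨b, h⟩))
      omega
    · rcases exists_clique_five_of_degree_le hv5 hv0 (hcontract v) with
        ⟨s, hs⟩ | ⟨a, c, hac, s, hs⟩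
      · exact hG.not_clique_five hH hs
      · exact hG.not_clique_five (hH.contract hac) hs

open Classical in
theorem IsPlanar.card_edgeFinset_le [Fintype W] (hG : IsPlanar G) {S : Finset W}
    {H : SimpleGraph W} (hS : 2 ≤ #S) (hH : IsMinor H G) (hHS : ∀ a b, H.Adj a b → a ∈ S) :
    #H.edgeFinset + 5 ≤ 3 * #S :=
  hG.card_edgeFinset_minor_le _ hS S H rfl hH hHS

end EdgeBound

/-! ### Degree sums, independent sets and the number of 2-classes -/

section PlanarBounds

variable {V : Type*} [Fintype V] [DecidableEq V] {G : SimpleGraph V} [DecidableRel G.Adj]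

theorem mem_projClass {X Y : Finset V} {v : V} :
    v ∈ projClass G X Y ↔ v ∉ X ∧ {x ∈ X | G.Adj v x} = Y := by
  simp [projClass]

theorem adj_of_mem_projClass {X Y : Finset V} {v x : V} (hv : v ∈ projClass G X Y) (hx : x ∈ Y) :
    G.Adj v x := by
  rw [mem_projClass] at hv
  rw [← hv.2, Finset.mem_filter] at hx
  exact hx.2

theorem projClass_unique {X Y Y' : Finset V} {v : V} (hv : v ∈ projClass G X Y)
    (hv' : v ∈ projClass G X Y') : Y = Y' := by
  rw [mem_projClass] at hv hv'
  exact hv.2.symm.trans hv'.2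

theorem mem_twoClassVertices {X : Finset V} {v : V} :
    v ∈ twoClassVertices G X ↔ v ∉ X ∧ #{x ∈ X | G.Adj v x} = 2 := by
  simp only [twoClassVertices, Finset.mem_biUnion, Finset.mem_powersetCard, mem_projClass]
  constructor
  · rintro ⟨Y, ⟨-, hY⟩, hv, rfl⟩
    exact ⟨hv, hY⟩
  · rintro ⟨hv, h2⟩
    exact ⟨_, ⟨Finset.filter_subset _ _, h2⟩, hv, rfl⟩

/-- The sum of the degrees of an induced subgraph of a planar graph. -/
theorem IsPlanar.sum_degree_le {V : Type*} [Fintype V] {G : SimpleGraph V} [DecidableRel G.Adj]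
    (hG : IsPlanar G) {S : Finset V} (hS : 2 ≤ #S) :
    ∑ v ∈ S, #{w ∈ S | G.Adj v w} + 10 ≤ 6 * #S := by
  classical
  obtain ⟨H, hadj⟩ : ∃ H : SimpleGraph V, ∀ a b, H.Adj a b ↔ a ∈ S ∧ b ∈ S ∧ G.Adj a b :=
    ⟨{ Adj a b := a ∈ S ∧ b ∈ S ∧ G.Adj a b
       symm := ⟨fun a b h => ⟨h.2.1, h.1, h.2.2.symm⟩⟩
       loopless := ⟨fun a h => G.loopless.irrefl a h.2.2⟩ }, fun _ _ => Iff.rfl⟩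
  have hH := hG.card_edgeFinset_le (H := H) hS
    (isMinor_of_le fun a b h => ((hadj a b).1 h).2.2) (fun a b h => ((hadj a b).1 h).1)
  have hsum : ∑ v ∈ S, #{w ∈ S | G.Adj v w} = ∑ v, H.degree v := by
    rw [← Finset.sum_subset (Finset.subset_univ S) (f := fun v => H.degree v)]
    · refine Finset.sum_congr rfl fun v hv => ?_
      rw [← H.card_neighborFinset_eq_degree]
      congr 1
      ext w
      simp [hadj, hv]
    · intro v _ hv
      rw [← H.card_neighborFinset_eq_degree, Finset.card_eq_zero,
        Finset.eq_empty_iff_forall_notMem]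
      intro w hw
      rw [SimpleGraph.mem_neighborFinset] at hw
      exact hv ((hadj v w).1 hw).1
  rw [hsum, H.sum_degrees_eq_twice_card_edges]
  omega

theorem IsPlanar.exists_degree_le_five {V : Type*} [Fintype V] {G : SimpleGraph V}
    [DecidableRel G.Adj] (hG : IsPlanar G) {S : Finset V} (hS : S.Nonempty) :
    ∃ v ∈ S, #{w ∈ S | G.Adj v w} ≤ 5 := by
  by_contra! h
  obtain ⟨v, hv⟩ := hS
  have h2 : 2 ≤ #S := by
    have := (h v hv).trans_le (Finset.card_filter_le _ _)
    omega
  have := hG.sum_degree_le h2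
  have := Finset.card_nsmul_le_sum S _ 6 (fun v hv => h v hv)
  rw [smul_eq_mul] at this
  omega

/-- Greedy choice: each selected vertex has degree at most five in what remains, so it costs at most
six vertices. -/
theorem IsPlanar.exists_isIndepSet_card (hG : IsPlanar G) (S : Finset V) :
    ∃ T ⊆ S, G.IsIndepSet (T : Set V) ∧ #S ≤ 6 * #T := by
  induction S using Finset.strongInduction with
  | H S ih =>
  rcases S.eq_empty_or_nonempty with rfl | hne
  · exact ⟨∅, subset_rfl, by simp [SimpleGraph.IsIndepSet], by simp⟩
  · obtain ⟨v, hv, h5⟩ := hG.exists_degree_le_five hne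
    set R := insert v ({w ∈ S | G.Adj v w} : Finset V) with hR
    have hRS : R ⊆ S := by
      rw [hR, Finset.insert_subset_iff]
      exact ⟨hv, Finset.filter_subset _ _⟩
    obtain ⟨T, hTS, hT, hTc⟩ := ih (S \ R) (Finset.sdiff_ssubset hRS ⟨v, by simp [hR]⟩)
    have hvT : v ∉ T := fun h => (Finset.mem_sdiff.1 (hTS h)).2 (by simp [hR])
    have hadj : ∀ w ∈ T, ¬ G.Adj v w := by
      intro w hw hvw
      have := Finset.mem_sdiff.1 (hTS hw)
      exact this.2 (by simp [hR, this.1, hvw])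
    refine ⟨insert v T, ?_, ?_, ?_⟩
    · rw [Finset.insert_subset_iff]
      exact ⟨hv, hTS.trans Finset.sdiff_subset⟩
    · rw [Finset.coe_insert, SimpleGraph.IsIndepSet, Set.pairwise_insert]
      exact ⟨hT, fun w hw _ => ⟨hadj w hw, fun h => hadj w hw h.symm⟩⟩
    · rw [Finset.card_insert_of_notMem hvT]
      have h1 := Finset.card_sdiff_add_card_eq_card hRS
      have h2 : #R ≤ 6 := (Finset.card_insert_le _ _).trans (by omega)
      omega

/-- The degree sum inside a set of vertices having two neighbours each in `X`. -/
theorem IsPlanar.sum_degree_twoClass_le (hG : IsPlanar G) {X W : Finset V} (hX : 2 ≤ #X)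
    (hW : W ⊆ twoClassVertices G X) :
    ∑ v ∈ W, #{w ∈ W | G.Adj v w} + 10 ≤ 2 * #W + 6 * #X := by
  have hdis : Disjoint X W :=
    Finset.disjoint_right.2 fun v hv => (mem_twoClassVertices.1 (hW hv)).1
  have h := hG.sum_degree_le (S := X ∪ W) (hX.trans (Finset.card_le_card Finset.subset_union_left))
  rw [Finset.card_union_of_disjoint hdis, Finset.sum_union hdis] at h
  -- The edges between `X` and `W` number 2|W|. Counted from both ends they use 4|W| of the degree
  -- sum of `X ∪ W`.
  have h1 : ∑ x ∈ X, #{w ∈ W | G.Adj x w} = 2 * #W := by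
    have := Finset.sum_card_bipartiteAbove_eq_sum_card_bipartiteBelow (s := X) (t := W) G.Adj
    simp only [Finset.bipartiteAbove, Finset.bipartiteBelow] at this
    rw [this, mul_comm, ← smul_eq_mul, ← Finset.sum_const]
    refine Finset.sum_congr rfl fun w hw => ?_
    simp_rw [G.adj_comm _ w]
    exact (mem_twoClassVertices.1 (hW hw)).2
  have h2 : ∑ x ∈ X, #{w ∈ W | G.Adj x w} ≤ ∑ x ∈ X, #{w ∈ X ∪ W | G.Adj x w} :=
    Finset.sum_le_sum fun x _ => Finset.card_le_card
      (Finset.filter_subset_filter _ Finset.subset_union_right)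
  have h3 : ∑ v ∈ W, #{w ∈ X ∪ W | G.Adj v w} = 2 * #W + ∑ v ∈ W, #{w ∈ W | G.Adj v w} := by
    rw [mul_comm 2, ← smul_eq_mul, ← Finset.sum_const, ← Finset.sum_add_distrib]
    refine Finset.sum_congr rfl fun w hw => ?_
    rw [Finset.filter_union, Finset.card_union_of_disjoint (Finset.disjoint_filter_filter hdis),
      (mem_twoClassVertices.1 (hW hw)).2]
  omega

/-- The number of nonempty 2-classes. -/
theorem IsPlanar.card_twoClasses_le (hG : IsPlanar G) {X : Finset V} (hX : 2 ≤ #X) :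
    #{Y ∈ X.powersetCard 2 | (projClass G X Y).Nonempty} + 5 ≤ 3 * #X := by
  classical
  set 𝒴 := {Y ∈ X.powersetCard 2 | (projClass G X Y).Nonempty} with h𝒴
  have hmem : ∀ Y ∈ 𝒴, Y ⊆ X ∧ #Y = 2 ∧ (projClass G X Y).Nonempty := by
    intro Y hY
    rw [h𝒴, Finset.mem_filter, Finset.mem_powersetCard] at hY
    exact ⟨hY.1.1, hY.1.2, hY.2⟩
  have hrep : ∀ Y, ∃ v, Y ∈ 𝒴 → v ∈ projClass G X Y := by
    intro Y
    by_cases hY : Y ∈ 𝒴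
    · obtain ⟨v, hv⟩ := (hmem Y hY).2.2
      exact ⟨v, fun _ => hv⟩
    · by_cases hV : Nonempty V
      · exact ⟨hV.some, fun h => absurd h hY⟩
      · have : X = ∅ := Finset.eq_empty_of_forall_notMem fun x _ => hV ⟨x⟩
        simp [this] at hX
  choose rep hrep using hrep
  have hσ : ∀ Y, ∃ v, Y ∈ 𝒴 → v ∈ Y := by
    intro Y
    rcases Y.eq_empty_or_nonempty with rfl | ⟨v, hv⟩
    · exact ⟨rep ∅, fun h => by simpa using (hmem _ h).2.1⟩
    · exact ⟨v, fun _ => hv⟩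
  choose σ hσ using hσ
  obtain ⟨H, hadj⟩ : ∃ H : SimpleGraph V, ∀ a b, H.Adj a b ↔ a ≠ b ∧ {a, b} ∈ 𝒴 :=
    ⟨{ Adj a b := a ≠ b ∧ {a, b} ∈ 𝒴
       symm := ⟨fun a b h => ⟨h.1.symm, by rw [Finset.pair_comm]; exact h.2⟩⟩
       loopless := ⟨fun a h => h.1 rfl⟩ }, fun _ _ => Iff.rfl⟩
  have hcard : #𝒴 ≤ #H.edgeFinset := by
    have : 𝒴 ⊆ H.edgeFinset.image Sym2.toFinset := by
      intro Y hY
      obtain ⟨a, b, hab, rfl⟩ := Finset.card_eq_two.1 (hmem Y hY).2.1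
      refine Finset.mem_image.2 ⟨s(a, b), ?_, Sym2.toFinset_mk_eq⟩
      rw [SimpleGraph.mem_edgeFinset, SimpleGraph.mem_edgeSet]
      exact (hadj a b).2 ⟨hab, hY⟩
    exact (Finset.card_le_card this).trans Finset.card_image_le
  have hHX : ∀ a b, H.Adj a b → a ∈ X := fun a b h =>
    (hmem _ ((hadj a b).1 h).2).1 (by simp)
  have hout : ∀ Y ∈ 𝒴, rep Y ∉ X := fun Y hY => (mem_projClass.1 (hrep Y hY)).1
  refine (Nat.add_le_add_right hcard 5).trans (hG.card_edgeFinset_le hX ?_ hHX)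
  -- The representative of each class is contracted into the key vertex `σ Y`, which turns `Y` into
  -- an edge on `X`.
  let B : V → Set V := fun x => {v | (v = x ∧ x ∈ X) ∨ ∃ Y ∈ 𝒴, σ Y = x ∧ v = rep Y}
  refine ⟨B, fun x => ?_, fun x y hxy => ?_, fun a b hab => ?_⟩
  · by_cases hx : x ∈ X
    · refine Linked.of_center (c := x) (.inl ⟨rfl, hx⟩) ?_
      rintro v (⟨rfl, -⟩ | ⟨Y, hY, rfl, rfl⟩)
      · exact .inl rfl
      · exact .inr (adj_of_mem_projClass (hrep Y hY) (hσ Y hY)).symm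
    · have : B x = ∅ := by
        rw [Set.eq_empty_iff_forall_notMem]
        rintro v (⟨-, h⟩ | ⟨Y, hY, rfl, -⟩)
        · exact hx h
        · exact hx ((hmem Y hY).1 (hσ Y hY))
      rw [this]
      exact .empty
  · rw [Set.disjoint_left]
    rintro v (⟨rfl, hv⟩ | ⟨Y, hY, rfl, rfl⟩) (⟨h, h'⟩ | ⟨Y', hY', rfl, h⟩)
    · exact hxy h
    · exact hout Y' hY' (h ▸ hv)
    · exact hout Y hY (h ▸ h')
    · exact hxy (by rw [projClass_unique (hrep Y hY) (h ▸ hrep Y' hY')])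
  · have hab𝒴 := ((hadj a b).1 hab).2
    have hr := hrep _ hab𝒴
    have hs := hσ _ hab𝒴
    have ha : a ∈ X := hHX a b hab
    have hb : b ∈ X := hHX b a hab.symm
    rw [Finset.mem_insert, Finset.mem_singleton] at hs
    rcases hs with hs | hs
    · exact ⟨rep {a, b}, .inr ⟨_, hab𝒴, hs, rfl⟩, b, .inl ⟨rfl, hb⟩,
        adj_of_mem_projClass hr (by simp)⟩
    · exact ⟨a, .inl ⟨rfl, ha⟩, rep {a, b}, .inr ⟨_, hab𝒴, hs, rfl⟩,
        (adj_of_mem_projClass hr (by simp)).symm⟩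

end PlanarBounds

/-! ### Structure of one class and of two classes with a common key vertex -/

section Local

variable {V : Type*} [Fintype V] [DecidableEq V] {G : SimpleGraph V} [DecidableRel G.Adj]

/-- A class with at least four vertices contains no triangle. -/
theorem IsPlanar.no_triangle_in_class (hG : IsPlanar G) {X : Finset V} {x y : V} (hxy : x ≠ y)
    {c a b d : V} (hc : c ∈ projClass G X {x, y}) (ha : a ∈ projClass G X {x, y})
    (hb : b ∈ projClass G X {x, y}) (hd : d ∈ projClass G X {x, y}) (hca : c ≠ a) (hcb : c ≠ b)
    (hcd : c ≠ d) (hab : G.Adj a b) (had : G.Adj a d) (hbd : G.Adj b d) : False := by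
  have hy : y ∈ ({x, y} : Finset V) := by simp
  have hx' : x ∈ ({x, y} : Finset V) := by simp
  have hcy := adj_of_mem_projClass hc hy
  have hcx := adj_of_mem_projClass hc hx'
  have lift : ∀ u w, G.Adj u w → u ≠ c → w ≠ c → (contract G y c).Adj u w :=
    fun u w h hu hw => ⟨h.ne, hu, hw, .inl h⟩
  have h3 : (contract G y c).IsNClique 3 {a, b, d} := by
    rw [SimpleGraph.is3Clique_triple_iff]
    exact ⟨lift _ _ hab hca.symm hcb.symm, lift _ _ had hca.symm hcd.symm,
      lift _ _ hbd hcb.symm hcd.symm⟩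
  -- Contracting `c` into `y` joins `x` to `y`, which completes the triangle to a K₅.
  refine hG.not_clique_five ((isMinor_of_le le_rfl).contract hcy.symm)
    ((h3.insert (a := x) ?_).insert (a := y) ?_)
  · intro w hw
    simp only [Finset.mem_insert, Finset.mem_singleton] at hw
    rcases hw with rfl | rfl | rfl
    · exact lift _ _ (adj_of_mem_projClass ha hx').symm hcx.ne' hca.symm
    · exact lift _ _ (adj_of_mem_projClass hb hx').symm hcx.ne' hcb.symm
    · exact lift _ _ (adj_of_mem_projClass hd hx').symm hcx.ne' hcd.symm
  · intro w hw
    simp only [Finset.mem_insert, Finset.mem_singleton] at hw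
    rcases hw with rfl | rfl | rfl | rfl
    · exact ⟨hxy.symm, hcy.ne', hcx.ne', .inr (.inl ⟨rfl, hcx⟩)⟩
    · exact lift _ _ (adj_of_mem_projClass ha hy).symm hcy.ne' hca.symm
    · exact lift _ _ (adj_of_mem_projClass hb hy).symm hcy.ne' hcb.symm
    · exact lift _ _ (adj_of_mem_projClass hd hy).symm hcy.ne' hcd.symm

theorem IsPlanar.exists_nonadj_pair (hG : IsPlanar G) {X : Finset V} {x y : V} (hxy : x ≠ y)
    {C T : Finset V} (hC : C ⊆ projClass G X {x, y}) (hC4 : 4 ≤ #C) (hT : T ⊆ C)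
    (hT3 : 3 ≤ #T) : ∃ a ∈ T, ∃ b ∈ T, a ≠ b ∧ ¬ G.Adj a b := by
  obtain ⟨U, hU, hU3⟩ := Finset.exists_subset_card_eq hT3
  obtain ⟨a, b, d, hab, had, hbd, rfl⟩ := Finset.card_eq_three.1 hU3
  obtain ⟨c, hc, hcU⟩ := Finset.exists_mem_notMem_of_card_lt_card (s := {a, b, d}) (t := C)
    (by omega)
  simp only [Finset.insert_subset_iff, Finset.singleton_subset_iff] at hU
  simp only [Finset.mem_insert, Finset.mem_singleton, not_or] at hcU
  by_contra! h
  exact hG.no_triangle_in_class hxy (hC hc) (hC (hT hU.1)) (hC (hT hU.2.1)) (hC (hT hU.2.2))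
    hcU.1 hcU.2.1 hcU.2.2 (h a hU.1 b hU.2.1 hab) (h a hU.1 d hU.2.2 had)
    (h b hU.2.1 d hU.2.2 hbd)

/-- The argument for R(3,3) = 6, with triangles excluded: three neighbours of `v` are independent,
and otherwise `v` has three non-neighbours, two of which are not adjacent. -/
theorem IsPlanar.exists_indep_triple (hG : IsPlanar G) {X : Finset V} {x y : V} (hxy : x ≠ y)
    {C : Finset V} (hC : C ⊆ projClass G X {x, y}) (hC6 : 6 ≤ #C) :
    ∃ T ⊆ C, #T = 3 ∧ G.IsIndepSet (T : Set V) := by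
  obtain ⟨v, hv⟩ : C.Nonempty := by rw [← Finset.card_pos]; omega
  have hsplit := Finset.card_filter_add_card_filter_not (s := C.erase v) (fun w => G.Adj v w)
  rw [Finset.card_erase_of_mem hv] at hsplit
  by_cases h : 3 ≤ #{w ∈ C.erase v | G.Adj v w}
  · obtain ⟨T, hT, hT3⟩ := Finset.exists_subset_card_eq h
    have hTm : ∀ w ∈ T, (w ≠ v ∧ w ∈ C) ∧ G.Adj v w := fun w hw => by
      simpa using hT hw
    refine ⟨T, fun w hw => (hTm w hw).1.2, hT3, fun a ha b hb hab hadj => ?_⟩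
    obtain ⟨c, hc, hcU⟩ := Finset.exists_mem_notMem_of_card_lt_card (s := {v, a, b}) (t := C)
      ((Finset.card_le_three).trans_lt (by omega))
    simp only [Finset.mem_insert, Finset.mem_singleton, not_or] at hcU
    exact hG.no_triangle_in_class hxy (hC hc) (hC hv) (hC (hTm a ha).1.2) (hC (hTm b hb).1.2)
      hcU.1 hcU.2.1 hcU.2.2 (hTm a ha).2 (hTm b hb).2 hadj
  · obtain ⟨a, ha, b, hb, hab, hnab⟩ := hG.exists_nonadj_pair hxy hC (by omega)
      (T := {w ∈ C.erase v | ¬ G.Adj v w})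
      ((Finset.filter_subset _ _).trans (Finset.erase_subset _ _)) (by omega)
    simp only [Finset.mem_filter, Finset.mem_erase] at ha hb
    refine ⟨{v, a, b}, ?_, Finset.card_eq_three.2 ⟨v, a, b, ha.1.1.symm, hb.1.1.symm, hab, rfl⟩, ?_⟩
    · simp [Finset.insert_subset_iff, hv, ha.1.2, hb.1.2]
    · intro u hu w hw huw
      simp only [Finset.coe_insert, Finset.coe_singleton, Set.mem_insert_iff,
        Set.mem_singleton_iff] at hu hw
      rcases hu with rfl | rfl | rfl <;> rcases hw with rfl | rfl | rfl <;>
        first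
          | exact absurd rfl huw
          | exact ha.2
          | exact hb.2
          | exact hnab
          | exact fun h => ha.2 h.symm
          | exact fun h => hb.2 h.symm
          | exact fun h => hnab h.symm

/-- In a class of at least four vertices, a vertex with a neighbour in an adjacent class `C'` has
a non-neighbour without neighbours in `C'`. -/
theorem IsPlanar.exists_partner (hG : IsPlanar G) {X : Finset V} {x y z : V}
    (hx : x ∈ X) (hy : y ∈ X) (hz : z ∈ X) (hxy : x ≠ y) (hxz : x ≠ z) (hyz : y ≠ z)
    {C C' : Finset V} (hC : C ⊆ projClass G X {x, y}) (hC' : C' ⊆ projClass G X {x, z})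
    (hC4 : 4 ≤ #C) {a a' : V} (ha : a ∈ C) (ha' : a' ∈ C') (haa' : G.Adj a a') :
    ∃ b ∈ C, b ≠ a ∧ ¬ G.Adj a b ∧ ∀ c' ∈ C', ¬ G.Adj b c' := by
  by_contra! h
  obtain ⟨U, hU, hU3⟩ := Finset.exists_subset_card_eq
    (show 3 ≤ #(C.erase a) by rw [Finset.card_erase_of_mem ha]; omega)
  obtain ⟨b, c, d, hbc, hbd, hcd, rfl⟩ := Finset.card_eq_three.1 hU3
  simp only [Finset.insert_subset_iff, Finset.singleton_subset_iff, Finset.mem_erase] at hU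
  obtain ⟨⟨hba, hb⟩, ⟨hca, hc⟩, hda, hd⟩ := hU
  have hout : ∀ w ∈ C, w ∉ X := fun w hw => (mem_projClass.1 (hC hw)).1
  have hout' : ∀ w ∈ C', w ∉ X := fun w hw => (mem_projClass.1 (hC' hw)).1
  have hdis : ∀ w ∈ C, w ∉ C' := by
    intro w hw hw'
    have : y ∈ ({x, z} : Finset V) := by
      rw [← projClass_unique (hC hw) (hC' hw')]; simp
    simp [hxy.symm, hyz] at this
  -- If the claim fails, every vertex of `C` other than `a` has a neighbour in this linked set.
  -- Together with `x` and `y` it forms one side of a K₃,₃ against three such vertices.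
  have hS : Linked G ({a} ∪ insert z (C' : Set V)) := by
    refine (Linked.singleton a).union (Linked.of_center (c := z) (by simp) ?_) rfl
      (b := a') (by simp [ha']) haa'
    rintro w (rfl | hw)
    · exact .inl rfl
    · exact .inr (adj_of_mem_projClass (hC' hw) (by simp)).symm
  have hnS : ∀ w ∈ C, w ≠ a → w ∉ ({a} ∪ insert z (C' : Set V)) := by
    rintro w hw hwa (h | rfl | h)
    exacts [hwa h, hout _ hw hz, hdis w hw h]
  have hnX : ∀ w ∈ X, w ≠ z → w ∉ ({a} ∪ insert z (C' : Set V)) := by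
    rintro w hw hwz (rfl | h | h)
    exacts [hout _ ha hw, hwz h, hout' w h hw]
  have hadj : ∀ w ∈ C, w ≠ a → ∃ s ∈ ({a} ∪ insert z (C' : Set V)), G.Adj s w := by
    intro w hw hwa
    by_cases haw : G.Adj a w
    · exact ⟨a, .inl rfl, haw⟩
    · obtain ⟨c', hc', hadj⟩ := h w hw hwa haw
      exact ⟨c', .inr (.inr hc'), hadj.symm⟩
  have hax : ∀ w ∈ C, G.Adj x w := fun w hw => (adj_of_mem_projClass (hC hw) (by simp)).symm
  have hay : ∀ w ∈ C, G.Adj y w := fun w hw => (adj_of_mem_projClass (hC hw) (by simp)).symm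
  exact hG.no_bipartite_star hS hxy hbc hbd hcd (hnX x hx hxz) (hnX y hy hyz) (hnS b hb hba)
    (hnS c hc hca) (hnS d hd hda) (hax b hb) (hax c hc) (hax d hd) (hay b hb) (hay c hc) (hay d hd)
    (hadj b hb hba) (hadj c hc hca) (hadj d hd hda)

/-- Two classes with a common key vertex, the second having at least three vertices, are not joined
by a four-cycle. -/
theorem IsPlanar.no_four_cycle_between (hG : IsPlanar G) {X : Finset V} {x y z : V}
    (hx : x ∈ X) (hz : z ∈ X) (hxy : x ≠ y) (hxz : x ≠ z) (hyz : y ≠ z)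
    {C C' : Finset V} (hC : C ⊆ projClass G X {x, y}) (hC' : C' ⊆ projClass G X {x, z})
    (hC3 : 3 ≤ #C') {a b a' b' : V} (ha : a ∈ C) (hb : b ∈ C) (ha' : a' ∈ C') (hb' : b' ∈ C')
    (hab : a ≠ b) (hab' : a' ≠ b') (h1 : G.Adj a a') (h2 : G.Adj a b') (h3 : G.Adj b a')
    (h4 : G.Adj b b') : False := by
  obtain ⟨c, hc, hcU⟩ := Finset.exists_mem_notMem_of_card_lt_card (s := {a', b'}) (t := C')
    (Finset.card_le_two.trans_lt (by omega))
  simp only [Finset.mem_insert, Finset.mem_singleton, not_or] at hcU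
  have hout : ∀ w ∈ C, w ∉ X := fun w hw => (mem_projClass.1 (hC hw)).1
  have hout' : ∀ w ∈ C', w ∉ X := fun w hw => (mem_projClass.1 (hC' hw)).1
  have hdis : ∀ w ∈ C, w ∉ C' := by
    intro w hw hw'
    have : y ∈ ({x, z} : Finset V) := by
      rw [← projClass_unique (hC hw) (hC' hw')]; simp
    simp [hxy.symm, hyz] at this
  have hax : ∀ w ∈ C, G.Adj x w := fun w hw => (adj_of_mem_projClass (hC hw) (by simp)).symm
  have hax' : ∀ w ∈ C', G.Adj x w := fun w hw => (adj_of_mem_projClass (hC' hw) (by simp)).symm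
  have haz' : ∀ w ∈ C', G.Adj w z := fun w hw => adj_of_mem_projClass (hC' hw) (by simp)
  -- The K₃,₃ has sides `a'`, `b'`, `{x, c}` and `a`, `b`, `z`. In the third branch set `x` reaches
  -- `a` and `b`, while `c` reaches `z`.
  have hS : Linked G {x, c} := Linked.of_center (c := x) (by simp) (by
    rintro w (rfl | rfl)
    exacts [.inl rfl, .inr (hax' _ hc)])
  have hnS : ∀ w, w ≠ x → w ≠ c → w ∉ ({x, c} : Set V) := by
    rintro w h h' (h'' | h'')
    exacts [h h'', h' h'']
  have hCx : ∀ w ∈ C, w ≠ x := fun w hw h => hout w hw (h ▸ hx)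
  have hCx' : ∀ w ∈ C', w ≠ x := fun w hw h => hout' w hw (h ▸ hx)
  have hCc : ∀ w ∈ C, w ≠ c := fun w hw h => hdis w hw (h ▸ hc)
  exact hG.no_bipartite_star hS hab' hab (fun h => hout a ha (h ▸ hz)) (fun h => hout b hb (h ▸ hz))
    (hnS a' (hCx' _ ha') (Ne.symm hcU.1)) (hnS b' (hCx' _ hb') (Ne.symm hcU.2))
    (hnS a (hCx a ha) (hCc a ha)) (hnS b (hCx b hb) (hCc b hb))
    (hnS z hxz.symm (fun h => hout' c hc (h ▸ hz)))
    h1.symm h3.symm (haz' _ ha') h2.symm h4.symm (haz' _ hb')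
    ⟨x, by simp, hax a ha⟩ ⟨x, by simp, hax b hb⟩ ⟨c, by simp, haz' c hc⟩

/-- Two classes with a common key vertex and at least four vertices each contain non-adjacent pairs
that are not joined by edges. -/
theorem IsPlanar.exists_two_two (hG : IsPlanar G) {X : Finset V} {x y z : V}
    (hx : x ∈ X) (hy : y ∈ X) (hz : z ∈ X) (hxy : x ≠ y) (hxz : x ≠ z) (hyz : y ≠ z)
    {C C' : Finset V} (hC : C ⊆ projClass G X {x, y}) (hC' : C' ⊆ projClass G X {x, z})
    (hC4 : 4 ≤ #C) (hC4' : 4 ≤ #C') :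
    ∃ a ∈ C, ∃ b ∈ C, ∃ a' ∈ C', ∃ b' ∈ C', a ≠ b ∧ a' ≠ b' ∧ ¬ G.Adj a b ∧ ¬ G.Adj a' b' ∧
      ¬ G.Adj a a' ∧ ¬ G.Adj a b' ∧ ¬ G.Adj b a' ∧ ¬ G.Adj b b' := by
  -- For such `a` and `a'`, a partner of each from `exists_partner` completes the two pairs.
  by_cases hex : ∃ a ∈ C, ∃ a' ∈ C', ¬ G.Adj a a' ∧ (∃ c' ∈ C', G.Adj a c') ∧ ∃ c ∈ C, G.Adj c a'
  · obtain ⟨a, ha, a', ha', hn, ⟨c', hc', hac'⟩, c, hc, hca'⟩ := hex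
    obtain ⟨b, hb, hba, hnb, hbC⟩ := hG.exists_partner hx hy hz hxy hxz hyz hC hC' hC4 ha hc' hac'
    obtain ⟨b', hb', hba', hnb', hbC'⟩ :=
      hG.exists_partner hx hz hy hxz hxy hyz.symm hC' hC hC4' ha' hc hca'.symm
    exact ⟨a, ha, b, hb, a', ha', b', hb', hba.symm, hba'.symm, hnb, hnb', hn,
      fun h => hbC' a ha h.symm, hbC a' ha', hbC b' hb'⟩
  · push Not at hex
    -- Now every vertex of `A` is adjacent to every vertex of `A'`. Two vertices on each side would
    -- give a forbidden four-cycle. If one side has at most one, deleting it leaves at least three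
    -- vertices with no edges across.
    set A : Finset V := {a ∈ C | ∃ c' ∈ C', G.Adj a c'} with hA
    set A' : Finset V := {a' ∈ C' | ∃ c ∈ C, G.Adj c a'} with hA'
    by_cases hA1 : #A ≤ 1
    · obtain ⟨a, ha, b, hb, hab, hnab⟩ := hG.exists_nonadj_pair hxy hC hC4 (T := C \ A)
        Finset.sdiff_subset (by
          have := Finset.le_card_sdiff A C
          omega)
      obtain ⟨a', ha', b', hb', hab', hnab'⟩ :=
        hG.exists_nonadj_pair hxz hC' hC4' subset_rfl (by omega)
      have key : ∀ w ∈ C \ A, ∀ w' ∈ C', ¬ G.Adj w w' := fun w hw w' hw' h => by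
        simp only [hA, Finset.mem_sdiff, Finset.mem_filter, not_and] at hw
        exact hw.2 hw.1 ⟨w', hw', h⟩
      exact ⟨a, (Finset.mem_sdiff.1 ha).1, b, (Finset.mem_sdiff.1 hb).1, a', ha', b', hb', hab,
        hab', hnab, hnab', key a ha a' ha', key a ha b' hb', key b hb a' ha', key b hb b' hb'⟩
    by_cases hA1' : #A' ≤ 1
    · obtain ⟨a', ha', b', hb', hab', hnab'⟩ := hG.exists_nonadj_pair hxz hC' hC4' (T := C' \ A')
        Finset.sdiff_subset (by
          have := Finset.le_card_sdiff A' C'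
          omega)
      obtain ⟨a, ha, b, hb, hab, hnab⟩ :=
        hG.exists_nonadj_pair hxy hC hC4 subset_rfl (by omega)
      have key : ∀ w ∈ C, ∀ w' ∈ C' \ A', ¬ G.Adj w w' := fun w hw w' hw' h => by
        simp only [hA', Finset.mem_sdiff, Finset.mem_filter, not_and] at hw'
        exact hw'.2 hw'.1 ⟨w, hw, h⟩
      exact ⟨a, ha, b, hb, a', (Finset.mem_sdiff.1 ha').1, b', (Finset.mem_sdiff.1 hb').1, hab,
        hab', hnab, hnab', key a ha a' ha', key a ha b' hb', key b hb a' ha', key b hb b' hb'⟩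
    · exfalso
      obtain ⟨a, ha, b, hb, hab⟩ := Finset.one_lt_card.1 (not_le.1 hA1)
      obtain ⟨a', ha', b', hb', hab'⟩ := Finset.one_lt_card.1 (not_le.1 hA1')
      have key : ∀ w ∈ A, ∀ w' ∈ A', G.Adj w w' := by
        intro w hw w' hw'
        rw [hA, Finset.mem_filter] at hw
        rw [hA', Finset.mem_filter] at hw'
        by_contra hn
        obtain ⟨c', hc', h1⟩ := hw.2
        obtain ⟨c, hc, h2⟩ := hw'.2
        exact hex w hw.1 w' hw'.1 hn ⟨c', hc', h1⟩ c hc h2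
      exact hG.no_four_cycle_between hx hz hxy hxz hyz hC hC' (by omega)
        (Finset.mem_filter.1 ha).1 (Finset.mem_filter.1 hb).1 (Finset.mem_filter.1 ha').1
        (Finset.mem_filter.1 hb').1 hab hab' (key a ha a' ha') (key a ha b' hb')
        (key b hb a' ha') (key b hb b' hb')

end Local

/-! ### Orderings of J built from counts of settled vertices -/

section Order

/-- Before index `t`, counted from zero, only `t` vertices are used, while `F (t + 1)` has at least
`t + 1`. The first two vertices are prescribed and need not lie in any `F t`. -/
theorem exists_injOn_choice {V : Type*} [DecidableEq V] {F : ℕ → Finset V} {k : ℕ}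
    (h : ∀ t, 2 ≤ t → t ≤ k → t ≤ #(F t))
    {a b : V} (hab : a ≠ b) (n : ℕ) (hn : 2 ≤ n) : n ≤ k →
    ∃ j : ℕ → V, Set.InjOn j {t | t < n} ∧ j 0 = a ∧ j 1 = b ∧
      ∀ t, 2 ≤ t → t < n → j t ∈ F (t + 1) := by
  induction n, hn using Nat.le_induction with
  | base =>
    intro _
    refine ⟨fun t => if t = 0 then a else b, ?_, rfl, rfl, fun t h1 h2 => by omega⟩
    intro s hs t ht hst
    simp only [Set.mem_ofPred_eq] at hs ht
    have hs' : s = 0 ∨ s = 1 := by omega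
    have ht' : t = 0 ∨ t = 1 := by omega
    rcases hs' with rfl | rfl <;> rcases ht' with rfl | rfl
    · rfl
    · exact absurd hst hab
    · exact absurd hst.symm hab
    · rfl
  | succ n hn ih =>
    intro hk
    obtain ⟨j, hj, h0, h1, hF⟩ := ih (by omega)
    obtain ⟨v, hv, hvj⟩ := Finset.exists_mem_notMem_of_card_lt_card
      (s := (Finset.range n).image j) (t := F (n + 1)) (by
        have := Finset.card_image_le (s := Finset.range n) (f := j)
        rw [Finset.card_range] at this
        have := h (n + 1) (by omega) hk
        omega)
    have hvj' : ∀ t, t < n → j t ≠ v := fun t ht e =>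
      hvj (Finset.mem_image.2 ⟨t, Finset.mem_range.2 ht, e⟩)
    refine ⟨fun t => if t = n then v else j t, ?_, ?_, ?_, ?_⟩
    · intro s hs t ht hst
      simp only [Set.mem_ofPred_eq] at hs ht
      dsimp only at hst
      split_ifs at hst with h1 h2 h2
      · omega
      · exact absurd hst.symm (hvj' t (by omega))
      · exact absurd hst (hvj' s (by omega))
      · exact hj (by simp only [Set.mem_ofPred_eq]; omega)
          (by simp only [Set.mem_ofPred_eq]; omega) hst
    · dsimp only; rw [if_neg (by omega)]; exact h0
    · dsimp only; rw [if_neg (by omega)]; exact h1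
    · intro t h2 ht
      dsimp only
      split_ifs with e
      · rw [e]; exact hv
      · exact hF t h2 (by omega)

variable {V : Type*} [DecidableEq V] {G : SimpleGraph V} [DecidableRel G.Adj]

/-- The vertices of `I` all of whose neighbours in `J` lie in `S`. -/
def settled (G : SimpleGraph V) [DecidableRel G.Adj] (J I S : Finset V) : Finset V :=
  {v ∈ I | ∀ u ∈ J, G.Adj v u → u ∈ S}

theorem mem_settled {J I S : Finset V} {v : V} :
    v ∈ settled G J I S ↔ v ∈ I ∧ ∀ u ∈ J, G.Adj v u → u ∈ S := by
  simp [settled]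

theorem settled_mono {J I S T : Finset V} (h : S ⊆ T) : settled G J I S ⊆ settled G J I T := by
  intro v
  simp only [mem_settled]
  exact fun ⟨h1, h2⟩ => ⟨h1, fun u hu huv => h (h2 u hu huv)⟩

theorem card_settled_erase {J I S : Finset V} {w : V} (hw : w ∈ J) :
    #(settled G J I (S.erase w)) + #{v ∈ settled G J I S | G.Adj v w} = #(settled G J I S) := by
  rw [← Finset.card_filter_add_card_filter_not (s := settled G J I S) (fun v => ¬ G.Adj v w)]
  simp only [not_not]
  congr 2
  ext v
  simp only [mem_settled, Finset.mem_filter, Finset.mem_erase]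
  constructor
  · rintro ⟨hv, h⟩
    exact ⟨⟨hv, fun u hu huv => (h u hu huv).2⟩, fun hvw => (h w hw hvw).1 rfl⟩
  · rintro ⟨⟨hv, h⟩, hn⟩
    exact ⟨hv, fun u hu huv => ⟨fun e => hn (e ▸ huv), h u hu huv⟩⟩

/-- Starting from a set with more settled vertices than elements, some element outside can be
removed last. -/
theorem exists_erase_settled {J I S₀ S : Finset V} (h2 : ∀ v ∈ I, #{u ∈ J | G.Adj v u} ≤ 2)
    (hS₀ : S₀ ⊂ S) (hS : S ⊆ J) (hf₀ : #S₀ + 1 ≤ #(settled G J I S₀))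
    (hf : #S ≤ #(settled G J I S)) :
    ∃ w ∈ S \ S₀, #S ≤ #(settled G J I (S.erase w)) + 1 := by
  by_contra! h
  have hdeg : ∀ w ∈ S \ S₀, #(settled G J I S) - #S + 2 ≤ #{v ∈ settled G J I S | G.Adj v w} := by
    intro w hw
    have h1 := card_settled_erase (G := G) (I := I) (S := S) (hS (Finset.mem_sdiff.1 hw).1)
    have h2 := h w hw
    omega
  have hnot : ∀ w ∈ S \ S₀, ∀ v ∈ settled G J I S₀, ¬ G.Adj v w := by
    intro w hw v hv hadj
    rw [Finset.mem_sdiff] at hw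
    exact hw.2 ((mem_settled.1 hv).2 w (hS hw.1) hadj)
  have hsub := settled_mono (G := G) (J := J) (I := I) hS₀.subset
  have hdiff := Finset.card_sdiff_add_card_eq_card hsub
  have hm := Finset.card_sdiff_add_card_eq_card hS₀.subset
  have hm1 : 1 ≤ #(S \ S₀) := Finset.card_pos.2 (Finset.sdiff_nonempty.2 hS₀.not_subset)
  -- Let m = |S \ S₀| and σ = f(S) - |S|, so that f(S) - f(S₀) ≤ σ + m - 1. Each vertex newly
  -- settled has at most two edges into S \ S₀, hence m(σ + 2) ≤ 2(σ + m - 1), which is false for m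
  -- ≥ 2. For m = 1 it has at most one such edge, and σ + 2 ≤ σ fails.
  rcases hm1.eq_or_lt with h1 | hlt
  · obtain ⟨w, hw⟩ := Finset.card_eq_one.1 h1.symm
    have hw' : w ∈ S \ S₀ := by simp [hw]
    have h3 : {v ∈ settled G J I S | G.Adj v w} ⊆ settled G J I S \ settled G J I S₀ := by
      intro v hv
      rw [Finset.mem_filter] at hv
      exact Finset.mem_sdiff.2 ⟨hv.1, fun hv' => hnot w hw' v hv' hv.2⟩
    have h4 := Finset.card_le_card h3
    have h5 := hdeg w hw'
    omega
  · have hlow := Finset.card_nsmul_le_sum (S \ S₀) _ _ hdeg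
    have hcount := Finset.sum_card_bipartiteAbove_eq_sum_card_bipartiteBelow (s := S \ S₀)
      (t := settled G J I S) (fun w v => G.Adj v w)
    simp only [Finset.bipartiteAbove, Finset.bipartiteBelow] at hcount
    have hup : ∑ v ∈ settled G J I S, #{w ∈ S \ S₀ | G.Adj v w} ≤
        #(settled G J I S \ settled G J I S₀) * 2 := by
      rw [← Finset.sum_sdiff hsub, Finset.sum_eq_zero (s := settled G J I S₀), add_zero]
      · refine Finset.sum_le_card_nsmul _ _ 2 fun v hv => ?_
        refine (Finset.card_le_card (Finset.filter_subset_filter _ ?_)).trans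
          (h2 v (mem_settled.1 (Finset.mem_sdiff.1 hv).1).1)
        exact Finset.sdiff_subset.trans hS
      · intro v hv
        rw [Finset.card_eq_zero, Finset.filter_eq_empty_iff]
        exact fun w hw => hnot w hw v hv
    rw [hcount, smul_eq_mul] at hlow
    obtain ⟨σ, hσ⟩ := Nat.exists_eq_add_of_le hf
    rw [show #(settled G J I S) - #S = σ by omega] at hlow
    have := Nat.mul_le_mul_right σ hlt
    have e : #(S \ S₀) * (σ + 2) = #(S \ S₀) * σ + #(S \ S₀) * 2 := by ring
    have e' : (Nat.succ 1) * σ = 2 * σ := rfl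
    omega

/-- `S` can be enumerated starting with the elements of `Z` so that from the second step on the
number of settled vertices is at least the number of elements enumerated. -/
def HasOrder (G : SimpleGraph V) [DecidableRel G.Adj] (J I Z S : Finset V) : Prop :=
  ∃ l : List V, l.Nodup ∧ l.toFinset = S ∧ Z ⊆ (l.take 2).toFinset ∧
    ∀ t, 2 ≤ t → t ≤ #S → t ≤ #(settled G J I (l.take t).toFinset)

theorem hasOrder_self {J I Z : Finset V} (hZ : #Z ≤ 2) (hf : #Z ≤ #(settled G J I Z)) :
    HasOrder G J I Z Z := by
  have hl : Z.toList.length ≤ 2 := by simpa using hZ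
  refine ⟨Z.toList, Z.nodup_toList, by simp, ?_, fun t h2 ht => ?_⟩
  · rw [List.take_of_length_le hl]; simp
  · rw [List.take_of_length_le (by omega), Finset.toList_toFinset]
    omega

theorem HasOrder.insert {J I Z S : Finset V} (h : HasOrder G J I Z S) {w : V} (hw : w ∉ S)
    (hf : #S + 1 ≤ #(settled G J I (insert w S))) : HasOrder G J I Z (insert w S) := by
  obtain ⟨l, hl, rfl, hZ, ht⟩ := h
  have hlen : #l.toFinset = l.length := List.toFinset_card_of_nodup hl
  have hwl : w ∉ l := by simpa using hw
  refine ⟨l ++ [w], ?_, ?_, ?_, fun t h2 htk => ?_⟩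
  · rw [List.nodup_append]
    refine ⟨hl, by simp, fun a ha b hb => ?_⟩
    rw [List.mem_singleton] at hb
    rintro rfl
    exact hwl (hb ▸ ha)
  · ext x; simp
  · refine hZ.trans fun x hx => ?_
    rw [List.mem_toFinset] at hx ⊢
    rw [List.take_append]
    exact List.mem_append_left _ hx
  · rw [Finset.card_insert_of_notMem hw] at htk
    rcases Nat.lt_or_ge #l.toFinset t with h | h
    · have : (l ++ [w]).take t = l ++ [w] := List.take_of_length_le (by simp; omega)
      rw [this, show (l ++ [w]).toFinset = Insert.insert w l.toFinset by ext x; simp]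
      omega
    · rw [List.take_append_of_le_length (by omega)]
      exact ht t h2 h

/-- The order is read backwards from the removals that take `J` down to `S₀`. Inside `S₀` the set
`Z` comes first, so the vertices it settles are available as activation pair. -/
theorem hasOrder_of_surplus {J I Z S₀ : Finset V} (h2 : ∀ v ∈ I, #{u ∈ J | G.Adj v u} ≤ 2)
    (hZ : #Z ≤ 2) (hfZ : #Z ≤ #(settled G J I Z)) (hZS : Z ⊆ S₀) (hZS' : #S₀ ≤ #Z + 1)
    (hS₀ : S₀ ⊆ J) (hf₀ : #S₀ + 1 ≤ #(settled G J I S₀)) (hJ : #J ≤ #I) :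
    HasOrder G J I Z J := by
  have hbase : HasOrder G J I Z S₀ := by
    rcases hZS.eq_or_ssubset with rfl | hss
    · exact hasOrder_self hZ hfZ
    · obtain ⟨w, hw, hwZ⟩ := Finset.exists_of_ssubset hss
      have heq : insert w Z = S₀ := Finset.eq_of_subset_of_card_le
        (Finset.insert_subset hw hZS) (by rw [Finset.card_insert_of_notMem hwZ]; exact hZS')
      rw [← heq]
      refine (hasOrder_self hZ hfZ).insert hwZ ?_
      rw [heq]
      have := Finset.card_lt_card hss
      omega
  have key : ∀ n, ∀ S, #S = n → S₀ ⊆ S → S ⊆ J → #S ≤ #(settled G J I S) →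
      HasOrder G J I Z S := by
    intro n
    induction n with
    | zero =>
      intro S hS hsub _ _
      rw [Finset.card_eq_zero] at hS
      subst hS
      rwa [Finset.subset_empty.1 hsub] at hbase
    | succ n ih =>
      intro S hS hsub hSJ hf
      rcases hsub.eq_or_ssubset with rfl | hss
      · exact hbase
      · obtain ⟨w, hw, hwf⟩ := exists_erase_settled h2 hss hSJ hf₀ hf
        rw [Finset.mem_sdiff] at hw
        have hc := Finset.card_erase_of_mem hw.1
        have := ih (S.erase w) (by omega) (Finset.subset_erase.2 ⟨hsub, hw.2⟩)
          ((Finset.erase_subset _ _).trans hSJ) (by omega)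
        have h' := this.insert (Finset.notMem_erase w S) (by
          rw [Finset.insert_erase hw.1]; omega)
        rwa [Finset.insert_erase hw.1] at h'
  refine key _ J rfl hS₀ subset_rfl (hJ.trans (Finset.card_le_card fun v hv => ?_))
  exact mem_settled.2 ⟨hv, fun u hu _ => hu⟩

/-- For t ≥ 2 the first t targets have all their J-neighbours among the first t elements of the
order. They are thus not adjacent to the remaining elements, and independence of `I` and `J` does
the rest. -/
theorem HasOrder.isWeaklyGreedyWith {J I Z : Finset V} (h : HasOrder G J I Z J)
    (hJ : G.IsIndepSet (J : Set V)) (hI : G.IsIndepSet (I : Set V)) (h2 : 2 ≤ #J) {a b : V}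
    (hab : a ≠ b) (ha : a ∈ settled G J I Z) (hb : b ∈ settled G J I Z) :
    IsWeaklyGreedyWith G J I a b := by
  obtain ⟨l, hl, hlJ, hZ, ht⟩ := h
  have hlen : l.length = #J := by rw [← hlJ, List.toFinset_card_of_nodup hl]
  have hlt : ∀ s : Fin #J, (s : ℕ) < l.length := fun s => s.2.trans_eq hlen.symm
  obtain ⟨j, hj, h0, h1, hF⟩ := exists_injOn_choice
    (F := fun t => settled G J I (l.take t).toFinset) ht hab #J h2 le_rfl
  have hZ2 := settled_mono (G := G) (J := J) (I := I) hZ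
  have hjF : ∀ s t, s < t → s < #J → 2 ≤ t → j s ∈ settled G J I (l.take t).toFinset := by
    intro s t hst hs h2t
    have hmono : ∀ r, r ≤ t → settled G J I (l.take r).toFinset ⊆
        settled G J I (l.take t).toFinset := fun r hr => settled_mono fun x hx => by
      rw [List.mem_toFinset] at hx ⊢
      exact (List.take_prefix_take_left (l := l) hr).subset hx
    rcases Nat.lt_or_ge s 2 with h | h
    · have : s = 0 ∨ s = 1 := by omega
      rcases this with rfl | rfl
      · rw [h0]; exact hmono 2 h2t (hZ2 ha)
      · rw [h1]; exact hmono 2 h2t (hZ2 hb)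
    · exact hmono (s + 1) hst (hF s h hs)
  have hi : ∀ s (hs : s < l.length), l[s] ∈ J := fun s hs => by
    rw [← hlJ, List.mem_toFinset]; exact List.getElem_mem hs
  refine ⟨h2, fun s => l[(s : ℕ)]'(hlt s), fun s => j s, ⟨?_, ?_, ?_, ?_, ?_⟩, h0, h1⟩
  · intro s t hst
    exact Fin.ext ((List.Nodup.getElem_inj_iff hl).1 hst)
  · exact fun s => hi _ _
  · intro s t hst
    exact Fin.ext (hj s.2 t.2 hst)
  · intro s
    exact (mem_settled.1 (hjF s #J s.2 s.2 h2)).1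
  · intro t h2t htJ
    have hcross : ∀ s r : Fin #J, (s : ℕ) < t → t ≤ (r : ℕ) →
        ¬ G.Adj (j s) (l[(r : ℕ)]'(hlt r)) := by
      intro s r hs hr hadj
      have := (mem_settled.1 (hjF s t hs s.2 h2t)).2 _ (hi r (hlt r)) hadj
      rw [List.mem_toFinset, List.mem_take_iff_getElem] at this
      obtain ⟨q, hq, hqr⟩ := this
      have := (List.Nodup.getElem_inj_iff hl).1 hqr
      omega
    have hjI : ∀ s : Fin #J, j s ∈ I := fun s => (mem_settled.1 (hjF s #J s.2 s.2 h2)).1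
    rintro x (⟨s, hs, rfl⟩ | ⟨s, hs, rfl⟩) y (⟨r, hr, rfl⟩ | ⟨r, hr, rfl⟩) hxy
    · exact hI (hjI s) (hjI r) hxy
    · exact hcross s r hs hr
    · exact fun h => hcross r s hr hs h.symm
    · exact hJ (hi s (hlt s)) (hi r (hlt r)) hxy

end Order

/-! ### Rich sets are clean -/

section Clean

variable {V : Type*} [Fintype V] [DecidableEq V] {G : SimpleGraph V} [DecidableRel G.Adj]

/-- `I` has three vertices in one 2-class or two vertices in each of two 2-classes with a common key
vertex. -/
def IsRich (G : SimpleGraph V) [DecidableRel G.Adj] (X I : Finset V) : Prop :=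
  (∃ Y ⊆ X, #Y = 2 ∧ 3 ≤ #(projClass G X Y ∩ I)) ∨
  ∃ Y ⊆ X, ∃ Y' ⊆ X, #Y = 2 ∧ #Y' = 2 ∧ Y ≠ Y' ∧ (∃ x, x ∈ Y ∧ x ∈ Y') ∧
    2 ≤ #(projClass G X Y ∩ I) ∧ 2 ≤ #(projClass G X Y' ∩ I)

theorem IsRich.mono {X I I' : Finset V} (h : IsRich G X I) (hI : I ⊆ I') : IsRich G X I' := by
  have hle : ∀ Y, #(projClass G X Y ∩ I) ≤ #(projClass G X Y ∩ I') := fun Y =>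
    Finset.card_le_card (Finset.inter_subset_inter_left hI)
  rcases h with ⟨Y, hY, h2, h3⟩ | ⟨Y, hY, Y', hY', h2, h2', hne, hx, h, h'⟩
  · exact .inl ⟨Y, hY, h2, h3.trans (hle Y)⟩
  · exact .inr ⟨Y, hY, Y', hY', h2, h2', hne, hx, h.trans (hle Y), h'.trans (hle Y')⟩

theorem projClass_inter_subset_settled {X Y J I : Finset V} (hJ : J ⊆ X) :
    projClass G X Y ∩ I ⊆ settled G J I (Y ∩ J) := by
  intro v hv
  rw [Finset.mem_inter, mem_projClass] at hv
  refine mem_settled.2 ⟨hv.2, fun u hu huv => Finset.mem_inter.2 ⟨?_, hu⟩⟩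
  rw [← hv.1.2]
  exact Finset.mem_filter.2 ⟨hJ hu, huv⟩

theorem IsRich.isClean {X J I : Finset V} (h : IsRich G X I) (hIX : I ⊆ twoClassVertices G X)
    (hJX : J ⊆ X) (hI : G.IsIndepSet (I : Set V)) (hJ : G.IsIndepSet (J : Set V))
    (h2 : 2 ≤ #J) (hJI : #J ≤ #I) : IsClean G X J I := by
  have hdeg : ∀ v ∈ I, #{u ∈ J | G.Adj v u} ≤ 2 := fun v hv =>
    (Finset.card_le_card (Finset.filter_subset_filter _ hJX)).trans
      (mem_twoClassVertices.1 (hIX hv)).2.le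
  have three : ∀ Y ⊆ X, #Y = 2 → 3 ≤ #(projClass G X Y ∩ I) → IsClean G X J I := by
    intro Y hY hY2 hY3
    have hsub := projClass_inter_subset_settled (G := G) (Y := Y) (I := I) hJX
    have hc := Finset.card_le_card hsub
    have hZ : #(Y ∩ J) ≤ 2 := hY2 ▸ Finset.card_le_card Finset.inter_subset_left
    obtain ⟨a, ha, b, hb, hab⟩ := Finset.one_lt_card.1 (show 1 < #(projClass G X Y ∩ I) by omega)
    refine .inr (.inl ⟨Y, hY, hY2, hY3, a, (Finset.mem_inter.1 ha).1, b,
      (Finset.mem_inter.1 hb).1, ?_⟩)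
    exact (hasOrder_of_surplus hdeg hZ (by omega) subset_rfl (by omega) Finset.inter_subset_right
      (by omega) hJI).isWeaklyGreedyWith hJ hI h2 hab (hsub ha) (hsub hb)
  rcases h with ⟨Y, hY, hY2, hY3⟩ | ⟨Y, hY, Y', hY', hY2, hY2', hne, ⟨x, hx, hx'⟩, hc, hc'⟩
  · exact three Y hY hY2 hY3
  -- (2,2)-cleanness needs the intersection with the first class to be exactly a pair; a larger
  -- intersection is already the previous case.
  · rcases hc.lt_or_eq with hc3 | hc2
    · exact three Y hY hY2 hc3
    obtain ⟨a, b, hab, hCab⟩ := Finset.card_eq_two.1 hc2.symm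
    refine .inr (.inr ⟨Y, hY, Y', hY', hY2, hY2', hne, ⟨x, hx, hx'⟩, hc', a, b, hCab, ?_⟩)
    have hsub := projClass_inter_subset_settled (G := G) (Y := Y) (I := I) hJX
    have hsub' := projClass_inter_subset_settled (G := G) (Y := Y') (I := I) hJX
    have hZ : #(Y ∩ J) ≤ 2 := hY2 ▸ Finset.card_le_card Finset.inter_subset_left
    have hZS : Y ∩ J ⊆ (Y ∪ Y') ∩ J := Finset.inter_subset_inter_right Finset.subset_union_left
    have hZS' : Y' ∩ J ⊆ (Y ∪ Y') ∩ J := Finset.inter_subset_inter_right Finset.subset_union_right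
    have hdis : Disjoint (projClass G X Y ∩ I) (projClass G X Y' ∩ I) :=
      Finset.disjoint_left.2 fun v hv hv' =>
        hne (projClass_unique (Finset.mem_inter.1 hv).1 (Finset.mem_inter.1 hv').1)
    have h4 := Finset.card_le_card (Finset.union_subset (hsub.trans (settled_mono hZS))
      (hsub'.trans (settled_mono hZS')))
    rw [Finset.card_union_of_disjoint hdis] at h4
    have hYx : #(Y'.erase x) = 1 := by rw [Finset.card_erase_of_mem hx', hY2']
    -- The common key vertex makes `(Y ∪ Y') ∩ J` at most one larger than `Y ∩ J`. It thus has at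
    -- most three elements, and they settle at least four vertices.
    have hsmall : (Y ∪ Y') ∩ J ⊆ (Y ∩ J) ∪ Y'.erase x := by
      intro v hv
      rw [Finset.mem_inter, Finset.mem_union] at hv
      rw [Finset.mem_union, Finset.mem_inter, Finset.mem_erase]
      by_cases hvY : v ∈ Y
      · exact .inl ⟨hvY, hv.2⟩
      · exact .inr ⟨fun e => hvY (e ▸ hx), hv.1.resolve_left hvY⟩
    have h5 := (Finset.card_le_card hsmall).trans (Finset.card_union_le _ _)
    have hc1 := Finset.card_le_card hsub
    exact (hasOrder_of_surplus hdeg hZ (by omega) hZS (by omega) Finset.inter_subset_right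
      (by omega) hJI).isWeaklyGreedyWith hJ hI h2 hab (hsub (by simp [hCab]))
      (hsub (by simp [hCab]))

/-- Every hybrid set has at most one vertex, so plain greediness holds. -/
theorem isClean_of_card_le_one {X J I : Finset V} (hJ : #J ≤ 1) (hJI : #J ≤ #I) :
    IsClean G X J I := by
  obtain ⟨i, hi⟩ : ∃ i : Fin #J → V, ∀ a, i a ∈ J :=
    ⟨fun a => (J.equivFin.symm a : V), fun a => (J.equivFin.symm a).2⟩
  obtain ⟨j, hj⟩ : ∃ j : Fin #J → V, ∀ a, j a ∈ I :=
    ⟨fun a => (I.equivFin.symm (a.castLE hJI) : V), fun a => (I.equivFin.symm _).2⟩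
  have hsub : Subsingleton (Fin #J) := ⟨fun a b => Fin.ext (by omega)⟩
  refine .inl ⟨i, j, Function.injective_of_subsingleton i, hi,
    Function.injective_of_subsingleton j, hj, fun t _ _ => ?_⟩
  rintro x (⟨a, ha, rfl⟩ | ⟨a, ha, rfl⟩) y (⟨b, hb, rfl⟩ | ⟨b, hb, rfl⟩) hxy
  · exact absurd (by rw [Subsingleton.elim a b]) hxy
  · exact absurd (Subsingleton.elim a b ▸ ha) (not_lt.2 hb)
  · exact absurd (Subsingleton.elim b a ▸ hb) (not_lt.2 ha)
  · exact absurd (by rw [Subsingleton.elim a b]) hxy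

end Clean

/-! ### Finding a large rich independent set -/

section Assembly

variable {V : Type*} [Fintype V] [DecidableEq V] {G : SimpleGraph V} [DecidableRel G.Adj]

/-- A large set of vertices in 2-classes contains a small independent rich set. -/
theorem IsPlanar.exists_rich (hG : IsPlanar G) {X W : Finset V} (hX : 2 ≤ #X)
    (hW : W ⊆ twoClassVertices G X) (hcard : 10 * #X < #W + 15) :
    ∃ Q ⊆ W, G.IsIndepSet (Q : Set V) ∧ #Q ≤ 4 ∧ IsRich G X Q := by
  by_contra hno
  set 𝒴 := {Y ∈ X.powersetCard 2 | (projClass G X Y).Nonempty} with h𝒴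
  have hmem : ∀ Y ∈ 𝒴, Y ⊆ X ∧ #Y = 2 := by
    intro Y hY
    rw [h𝒴, Finset.mem_filter, Finset.mem_powersetCard] at hY
    exact hY.1
  have hle5 : ∀ Y ∈ 𝒴, #(projClass G X Y ∩ W) ≤ 5 := by
    intro Y hY
    obtain ⟨hYX, hY2⟩ := hmem Y hY
    obtain ⟨x, y, hxy, rfl⟩ := Finset.card_eq_two.1 hY2
    by_contra! h6
    obtain ⟨T, hT, hT3, hTi⟩ := hG.exists_indep_triple hxy
      Finset.inter_subset_left h6
    rw [Finset.subset_inter_iff] at hT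
    refine hno ⟨T, hT.2, hTi, by omega, .inl ⟨_, hYX, hY2, ?_⟩⟩
    rw [Finset.inter_eq_right.2 hT.1, hT3]
  set big := {Y ∈ 𝒴 | 4 ≤ #(projClass G X Y ∩ W)} with hbig
  have hdis : ∀ Y ∈ big, ∀ Y' ∈ big, Y ≠ Y' → Disjoint Y Y' := by
    intro Y hY Y' hY' hne
    rw [hbig, Finset.mem_filter] at hY hY'
    obtain ⟨hYX, hY2⟩ := hmem Y hY.1
    obtain ⟨hYX', hY2'⟩ := hmem Y' hY'.1
    rw [Finset.disjoint_left]
    intro x hx hx'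
    obtain ⟨y, hy⟩ := Finset.card_eq_one.1 (show #(Y.erase x) = 1 by
      rw [Finset.card_erase_of_mem hx, hY2])
    obtain ⟨z, hz⟩ := Finset.card_eq_one.1 (show #(Y'.erase x) = 1 by
      rw [Finset.card_erase_of_mem hx', hY2'])
    have hyY : y ∈ Y.erase x := by simp [hy]
    have hzY : z ∈ Y'.erase x := by simp [hz]
    obtain rfl : Y = {x, y} := by rw [← Finset.insert_erase hx, hy]
    obtain rfl : Y' = {x, z} := by rw [← Finset.insert_erase hx', hz]
    have hyz : y ≠ z := by rintro rfl; exact hne rfl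
    rw [Finset.mem_erase] at hyY hzY
    obtain ⟨a, ha, b, hb, a', ha', b', hb', hab, hab', n1, n2, n3, n4, n5, n6⟩ :=
      hG.exists_two_two (hYX hx) (hYX hyY.2) (hYX' hzY.2) hyY.1.symm hzY.1.symm hyz
        Finset.inter_subset_left Finset.inter_subset_left hY.2 hY'.2
    rw [Finset.mem_inter] at ha hb ha' hb'
    refine hno ⟨{a, b, a', b'}, ?_, ?_, Finset.card_le_four, .inr ⟨_, hYX, _, hYX', hY2, hY2', hne,
      ⟨x, hx, hx'⟩, ?_, ?_⟩⟩
    · simp [Finset.insert_subset_iff, ha.2, hb.2, ha'.2, hb'.2]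
    · intro u hu w hw huw
      simp only [Finset.coe_insert, Finset.coe_singleton, Set.mem_insert_iff,
        Set.mem_singleton_iff] at hu hw
      rcases hu with rfl | rfl | rfl | rfl <;> rcases hw with rfl | rfl | rfl | rfl <;>
        first
          | exact absurd rfl huw
          | assumption
          | exact fun h => absurd h.symm ‹_›
    · rw [← Finset.card_pair hab]
      exact Finset.card_le_card (by simp [Finset.insert_subset_iff, ha.1, hb.1])
    · rw [← Finset.card_pair hab']
      exact Finset.card_le_card (by simp [Finset.insert_subset_iff, ha'.1, hb'.1])
  have hbig2 : 2 * #big ≤ #X := by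
    have h1 : #(big.biUnion id) = ∑ Y ∈ big, #Y := Finset.card_biUnion hdis
    have h2 : ∑ Y ∈ big, #Y = #big * 2 :=
      Finset.sum_const_nat fun Y hY => (hmem Y (Finset.mem_filter.1 hY).1).2
    have h3 : #(big.biUnion id) ≤ #X := Finset.card_le_card
      (Finset.biUnion_subset.2 fun Y hY => (hmem Y (Finset.mem_filter.1 hY).1).1)
    omega
  have hcover : W ⊆ 𝒴.biUnion fun Y => projClass G X Y ∩ W := by
    intro v hv
    have hv' := hW hv
    rw [twoClassVertices, Finset.mem_biUnion] at hv'
    obtain ⟨Y, hY, hvY⟩ := hv'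
    exact Finset.mem_biUnion.2 ⟨Y, Finset.mem_filter.2 ⟨hY, v, hvY⟩, Finset.mem_inter.2 ⟨hvY, hv⟩⟩
  -- No class exceeds five, and the classes with more than three are pairwise disjoint pairs of key
  -- vertices. Hence |W| ≤ 3(3|X| - 5) + |X| = 10|X| - 15.
  have hsum : ∑ Y ∈ 𝒴, #(projClass G X Y ∩ W) ≤
      ∑ Y ∈ 𝒴, (3 + if 4 ≤ #(projClass G X Y ∩ W) then 2 else 0) := by
    refine Finset.sum_le_sum fun Y hY => ?_
    have := hle5 Y hY
    split_ifs <;> omega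
  rw [Finset.sum_add_distrib, Finset.sum_const, ← Finset.sum_filter, Finset.sum_const, smul_eq_mul,
    smul_eq_mul, ← hbig] at hsum
  have h1 := (Finset.card_le_card hcover).trans Finset.card_biUnion_le
  have h2 := hG.card_twoClasses_le hX
  rw [← h𝒴] at h2
  omega

/-- A set of at least `21k` vertices in 2-classes contains an independent rich set of at least `k`
vertices. -/
theorem IsPlanar.exists_large_rich (hG : IsPlanar G) {X : Finset V} {k : ℕ} (hk : 1 ≤ k)
    (hX : 2 ≤ #X) (hXk : #X ≤ 2 * k) (h21 : 21 * k ≤ #(twoClassVertices G X)) :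
    ∃ Q I, Q ⊆ I ∧ I ⊆ twoClassVertices G X ∧ G.IsIndepSet (I : Set V) ∧ #Q ≤ 4 ∧ k ≤ #I ∧
      IsRich G X Q := by
  obtain ⟨W, hW, hWk⟩ := Finset.exists_subset_card_eq h21
  -- The degree sum in `W` is at most 54k - 10. Fifteen vertices of degree at least 15k/4 would
  -- exceed it, as 225k > 216k - 40. Removing at most 14 leaves 21k - 14 > 10|X| - 15 vertices.
  set T : Finset V := {v ∈ W | 15 * k ≤ 4 * #{w ∈ W | G.Adj v w}} with hT
  have hT14 : #T ≤ 14 := by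
    have h1 := hG.sum_degree_twoClass_le hX hW
    have h2 : ∑ v ∈ T, #{w ∈ W | G.Adj v w} ≤ ∑ v ∈ W, #{w ∈ W | G.Adj v w} :=
      Finset.sum_le_sum_of_subset (Finset.filter_subset _ _)
    have h3 : #T * (15 * k) ≤ ∑ v ∈ T, 4 * #{w ∈ W | G.Adj v w} :=
      Finset.card_nsmul_le_sum T _ _ fun v hv => (Finset.mem_filter.1 hv).2
    rw [← Finset.mul_sum] at h3
    by_contra! h15
    have h4 : 15 * (15 * k) ≤ #T * (15 * k) := Nat.mul_le_mul_right _ h15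
    omega
  have hWT := Finset.card_sdiff_add_card_eq_card (show T ⊆ W from Finset.filter_subset _ _)
  obtain ⟨Q, hQ, hQi, hQ4, hQr⟩ := hG.exists_rich hX (W := W \ T)
    (Finset.sdiff_subset.trans hW) (by omega)
  have hQW : Q ⊆ W := hQ.trans Finset.sdiff_subset
  set R := W \ (Q ∪ Q.biUnion fun q => {w ∈ W | G.Adj q w}) with hR
  -- The at most four vertices of `Q` have fewer than 15k neighbours in total. The slack 5 is
  -- harmless: 6|S| ≥ 6k - 5 still forces |S| ≥ k.
  have hRc : 6 * k ≤ #R + 5 := by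
    have h1 : #(Q.biUnion fun q => {w ∈ W | G.Adj q w}) ≤ ∑ q ∈ Q, #{w ∈ W | G.Adj q w} :=
      Finset.card_biUnion_le
    have h2 : ∑ q ∈ Q, 4 * #{w ∈ W | G.Adj q w} ≤ #Q * (15 * k - 1) := by
      refine Finset.sum_le_card_nsmul _ _ _ fun q hq => ?_
      have := hQ hq
      simp only [hT, Finset.mem_sdiff, Finset.mem_filter, not_and, not_le] at this
      have := this.2 this.1
      omega
    rw [← Finset.mul_sum] at h2
    have h3 : #Q * (15 * k - 1) ≤ 4 * (15 * k - 1) := Nat.mul_le_mul_right _ hQ4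
    have h4 := Finset.le_card_sdiff (Q ∪ Q.biUnion fun q => {w ∈ W | G.Adj q w}) W
    have h5 := Finset.card_union_le Q (Q.biUnion fun q => {w ∈ W | G.Adj q w})
    rw [← hR] at h4
    omega
  obtain ⟨S, hS, hSi, hSc⟩ := hG.exists_isIndepSet_card R
  have hcross : ∀ q ∈ Q, ∀ w ∈ S, ¬ G.Adj q w := by
    intro q hq w hw hadj
    have := hS hw
    rw [hR, Finset.mem_sdiff, Finset.mem_union, Finset.mem_biUnion] at this
    exact this.2 (.inr ⟨q, hq, Finset.mem_filter.2 ⟨this.1, hadj⟩⟩)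
  refine ⟨Q, Q ∪ S, Finset.subset_union_left, Finset.union_subset (hQW.trans hW)
    ((hS.trans Finset.sdiff_subset).trans hW), ?_, hQ4, ?_, hQr⟩
  · intro u hu w hw huw
    rw [Finset.mem_coe, Finset.mem_union] at hu hw
    rcases hu with hu | hu <;> rcases hw with hw | hw
    · exact hQi hu hw huw
    · exact hcross u hu w hw
    · exact fun h => hcross w hw u hu h.symm
    · exact hSi hu hw huw
  · have := Finset.card_le_card (Finset.subset_union_right (s₁ := Q) (s₂ := S))
    omega

end Assembly

end TokenJumping

theorem mainTheorem5 {V : Type*} [Fintype V] [DecidableEq V] (G : SimpleGraph V)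
    [DecidableRel G.Adj] (hG : TokenJumping.IsPlanar G) (k : ℕ) (Is It : Finset V)
    (hIs : G.IsIndepSet (Is : Set V)) (hIt : G.IsIndepSet (It : Set V))
    (hIsk : #Is = k) (hItk : #It = k)
    (h21 : 21 * k ≤ #(TokenJumping.twoClassVertices G (Is ∪ It))) :
    ∃ I : Finset V, I ⊆ TokenJumping.twoClassVertices G (Is ∪ It) ∧
      G.IsIndepSet (I : Set V) ∧ #I ≤ 2 * k ∧
      TokenJumping.IsClean G (Is ∪ It) Is I ∧ TokenJumping.IsClean G (Is ∪ It) It I := by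
  rcases Nat.lt_or_ge k 2 with hk | hk
  · obtain ⟨I, hI, hIk⟩ := Finset.exists_subset_card_eq
      (show k ≤ #(TokenJumping.twoClassVertices G (Is ∪ It)) by omega)
    refine ⟨I, hI, ?_, by omega, TokenJumping.isClean_of_card_le_one (by omega) (by omega),
      TokenJumping.isClean_of_card_le_one (by omega) (by omega)⟩
    intro u hu w hw huw
    exact absurd (Finset.card_le_one.1 (by omega) u hu w hw) huw
  · have hX2 : 2 ≤ #(Is ∪ It) := by
      have := Finset.card_le_card (Finset.subset_union_left (s₁ := Is) (s₂ := It))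
      omega
    have hXk : #(Is ∪ It) ≤ 2 * k := (Finset.card_union_le _ _).trans (by omega)
    obtain ⟨Q, I₀, hQI, hI₀, hI₀i, hQ4, hkI, hQr⟩ :=
      hG.exists_large_rich (by omega) hX2 hXk h21
    -- The size `max #Q k` retains `Q`, and with it richness, and is at most 2k because `#Q ≤ 4` and
    -- k ≥ 2.
    obtain ⟨I, hQ, hI, hIc⟩ := Finset.exists_subsuperset_card_eq hQI
      (le_max_left #Q k) (max_le (Finset.card_le_card hQI) hkI)
    have hIr := hQr.mono hQ
    have hIi : G.IsIndepSet (I : Set V) := hI₀i.mono (by exact_mod_cast hI)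
    exact ⟨I, hI.trans hI₀, hIi, by omega,
      hIr.isClean (hI.trans hI₀) Finset.subset_union_left hIi hIs (by omega) (by omega),
      hIr.isClean (hI.trans hI₀) Finset.subset_union_right hIi hIt (by omega) (by omega)⟩
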